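/- Notation. For $v\in\mathbb R^n$ and $T\subset[n]$ let $v_T$ be the restriction of $v$ to $T$. A matrix $A\in\mathbb R^{k\times n}$ has the robust null space property (NSP) of order $s$ with constants $0<\gamma<1$ and $\tau>0$ if $\|Av\|_2\ge 1/\tau$ for every $v\in\mathbb R^n$ with $\|v\|_2=1$ such that $\|v_T\|_2\ge\frac{\gamma}{\sqrt s}\|v_{T^c}\|_1$ for some $T\subset[n]$ with $|T|=s$. Let $\sigma_s(x)_1=\inf\{\|x-z\|_1:\ z\text{ has at most } s \text{ non-zero entries}\}$, and let $\|D\|$ be the $\ell_2\to\ell_2$ operator norm. Theorem. Let $\alpha\ge\frac12$, $\lambda>0$ and $\kappa>0$. There are constants $C,c,K,R>0$, depending only on $\alpha,\lambda,\kappa$, such that the following holds for all natural numbers $m,d,n,s$ with $1\le s\le n/2$. Let $D=[d_1,\dots,d_n]\in\mathbb R^{d\times n}$ have the robust NSP of order $s$ with constants $0<\gamma<1$ and $\tau>0$, and let $\max_{i}\|d_i\|_2\le\rho$. Let $\Phi\in\mathbb R^{m\times d}$ be a random matrix with i.i.d. rows distributed as $\varphi/\sqrt m$, where $\varphi=(\xi_1,\dots,\xi_d)$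 has independent entries with $\mathbb E[\xi_i]=0$, $\mathbb E[\xi_i^2]=1$, and $$\|\xi_i\|_{L^p}\le\lambda p^{\alpha}\qquad\text{for all real } p \text{ with } 2\le p\le\max\bigl(4,\ \kappa\log(n/s)\bigr),\quad i\in[d].$$ If $$m\ \ge\ C\max\Bigl(\tfrac{\rho^2\tau^2}{\gamma^2}\,s\log(n/s),\ \bigl(\log(n/s)\bigr)^{\max(2\alpha-1,1)}\Bigr),$$ then, with probability at least $1-e^{-cm}$, the following two statements hold. 1. $\Phi D$ has the robust NSP of order $s$ with constants $\gamma$ and $\widetilde\tau=K\tau$. 2. For all $x_0\in\mathbb R^n$, with $z_0=Dx_0$, all $\varepsilon\ge 0$ and all $e\in\mathbb R^m$ with $\|e\|_2\le\varepsilon$, put $y=\Phi z_0+e$. The $\ell_1$-synthesis program "minimize $\|x\|_1$ over $x\in\mathbb R^n$ subject to $\|\Phi Dx-y\|_2\le\varepsilon$" has a solution, and every solution $\hat x$, with $\hat z=D\hat x$, satisfies $$\|\hat x-x_0\|_2\le\frac{R}{1-\gamma}\Bigl(\frac{\sigma_s(x_0)_1}{\sqrt s}+\tau\varepsilon\Bigr),\qquad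 \|\hat z-z_0\|_2\le\frac{R}{1-\gamma}\,\|D\|\Bigl(\frac{\sigma_s(x_0)_1}{\sqrt s}+\tau\varepsilon\Bigr).$$ -/

import Mathlib

open MeasureTheory ProbabilityTheory

noncomputable section

namespace DictRecovery

/-- The matrix-vector product `A v`, as a vector of the Euclidean space `ℝ^m`. -/
def mulVecE {m n : ℕ} (A : Matrix (Fin m) (Fin n) ℝ) (v : EuclideanSpace ℝ (Fin n)) :
    EuclideanSpace ℝ (Fin m) :=
  Matrix.toEuclideanLin A v

/-- The operator norm of a matrix with respect to the Euclidean norms. -/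
def opNorm {m n : ℕ} (A : Matrix (Fin m) (Fin n) ℝ) : ℝ :=
  ‖LinearMap.toContinuousLinearMap (Matrix.toEuclideanLin A)‖

/-- The `j`-th column of a matrix, as a vector of the Euclidean space `ℝ^m`. -/
def columnE {m n : ℕ} (A : Matrix (Fin m) (Fin n) ℝ) (j : Fin n) : EuclideanSpace ℝ (Fin m) :=
  WithLp.toLp 2 (fun i => A i j)

/-- The `ℓ₁`-norm of the restriction `v_T` of `v` to an index set `T`. -/
def l1On {n : ℕ} (T : Finset (Fin n)) (v : EuclideanSpace ℝ (Fin n)) : ℝ :=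
  ∑ i ∈ T, |v i|

/-- The `ℓ₂`-norm of the restriction `v_T` of `v` to an index set `T`. -/
def l2On {n : ℕ} (T : Finset (Fin n)) (v : EuclideanSpace ℝ (Fin n)) : ℝ :=
  Real.sqrt (∑ i ∈ T, v i ^ 2)

/-- The `ℓ₁`-norm. -/
def l1Norm {n : ℕ} (v : EuclideanSpace ℝ (Fin n)) : ℝ :=
  ∑ i, |v i|

/-- The vector `v` has at most `s` non-zero coordinates. -/
def IsSparse {n : ℕ} (s : ℕ) (v : EuclideanSpace ℝ (Fin n)) : Prop :=
  {i : Fin n | v i ≠ 0}.ncard ≤ s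

/-- The `ℓ₁`-error `σ_s(x)₁` of the best `s`-term approximation of `x`. -/
def bestTermError {n : ℕ} (s : ℕ) (x : EuclideanSpace ℝ (Fin n)) : ℝ :=
  sInf ((fun z => l1Norm (x - z)) '' {z | IsSparse s z})

/-- The set `S_γ` of unit vectors `v` with `‖v_T‖₂ ≥ (γ / √s) ‖v_{Tᶜ}‖₁` for some index set `T`
of size `s`. -/
def nspSet (n s : ℕ) (γ : ℝ) : Set (EuclideanSpace ℝ (Fin n)) :=
  {v | ‖v‖ = 1 ∧ ∃ T : Finset (Fin n), T.card = s ∧ γ / Real.sqrt s * l1On Tᶜ v ≤ l2On T v}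

/-- The robust null space property of order `s` with constants `0 < γ < 1` and `τ > 0`:
`‖A v‖₂ ≥ 1 / τ` on `S_γ`. -/
def RobustNSP {m n : ℕ} (A : Matrix (Fin m) (Fin n) ℝ) (s : ℕ) (γ τ : ℝ) : Prop :=
  0 < γ ∧ γ < 1 ∧ 0 < τ ∧ ∀ v ∈ nspSet n s γ, 1 / τ ≤ ‖mulVecE A v‖

/-- The random vector `φ` in `ℝ^d` has independent, centered entries of unit variance, and every
entry has an `L^p`-norm of at most `lam * p ^ α` for all real `p` with `2 ≤ p ≤ q`. -/
structure WellBehavedEntries {Ω : Type*} [MeasurableSpace Ω] (P : Measure Ω) {d : ℕ}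
    (φ : Ω → Fin d → ℝ) (α lam q : ℝ) : Prop where
  aemeasurable : ∀ j, AEMeasurable (fun ω => φ ω j) P
  indep : iIndepFun (fun (j : Fin d) (ω : Ω) => φ ω j) P
  mean : ∀ j, ∫ ω, φ ω j ∂P = 0
  variance : ∀ j, ∫ ω, φ ω j ^ 2 ∂P = 1
  moment : ∀ j, ∀ p : ℝ, 2 ≤ p → p ≤ q →
    eLpNorm (fun ω => φ ω j) (ENNReal.ofReal p) P ≤ ENNReal.ofReal (lam * p ^ α)

/-- The rows of the random matrix `Φ` (on the space `(Ω, P)`) are independent and distributed as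
`φ / √m` (where `φ` lives on the space `(Ω', P')`). -/
structure HasIIDRows {Ω Ω' : Type*} [MeasurableSpace Ω] [MeasurableSpace Ω'] (P : Measure Ω)
    (P' : Measure Ω') {m d : ℕ} (Φ : Ω → Matrix (Fin m) (Fin d) ℝ) (φ : Ω' → Fin d → ℝ) :
    Prop where
  indep : iIndepFun (fun (i : Fin m) (ω : Ω) => (fun j => Φ ω i j : Fin d → ℝ)) P
  law : ∀ i : Fin m, IdentDistrib (fun ω => (fun j => Φ ω i j : Fin d → ℝ))
    (fun ω' => (fun j => φ ω' j / Real.sqrt m : Fin d → ℝ)) P P'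

/-- `x` solves the `ℓ₁`-synthesis program: it minimizes `‖x‖₁` subject to `‖Φ D x - y‖₂ ≤ ε`. -/
def IsSynthesisSolution {m d n : ℕ} (Φ : Matrix (Fin m) (Fin d) ℝ) (D : Matrix (Fin d) (Fin n) ℝ)
    (y : EuclideanSpace ℝ (Fin m)) (ε : ℝ) (x : EuclideanSpace ℝ (Fin n)) : Prop :=
  ‖mulVecE (Φ * D) x - y‖ ≤ ε ∧ ∀ x', ‖mulVecE (Φ * D) x' - y‖ ≤ ε → l1Norm x ≤ l1Norm x'

/-- Stable and robust recovery by `ℓ₁`-synthesis, with constant `R` and noise amplification `τ`: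
for all coefficients `x₀`, with signal `z₀ = D x₀`, and all noise vectors `e` with `‖e‖₂ ≤ ε`, the
program with `y = Φ z₀ + e` has a solution, and for every solution `x` the errors of `x` and of
`D x` are at most `R (σ_s(x₀)₁ / √s + τ ε)` and `R ‖D‖ (σ_s(x₀)₁ / √s + τ ε)`. -/
def StableRobustRecovery {m d n : ℕ} (Φ : Matrix (Fin m) (Fin d) ℝ)
    (D : Matrix (Fin d) (Fin n) ℝ) (s : ℕ) (R τ : ℝ) : Prop :=
  ∀ (x₀ : EuclideanSpace ℝ (Fin n)) (e : EuclideanSpace ℝ (Fin m)) (ε : ℝ), ‖e‖ ≤ ε →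
    (∃ x, IsSynthesisSolution Φ D (mulVecE Φ (mulVecE D x₀) + e) ε x) ∧
    ∀ x, IsSynthesisSolution Φ D (mulVecE Φ (mulVecE D x₀) + e) ε x →
      ‖x - x₀‖ ≤ R * (bestTermError s x₀ / Real.sqrt s + τ * ε) ∧
      ‖mulVecE D x - mulVecE D x₀‖ ≤
        R * (opNorm D * (bestTermError s x₀ / Real.sqrt s + τ * ε))

end DictRecovery

end

/-! By Cauchy–Schwarz, ‖ΦDv‖₂ is at least the empirical mean of |⟨φ_i, Dv⟩| over the m unscaled rows
φ_i. So the NSP of ΦD follows from a lower bound, uniform over `nspSet` (S_γ), for an ℓ₁-average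
(`robustNSP_of_le_sum_abs`). Passing from the NSP to recovery is deterministic
(`RobustNSP.stableRobustRecovery`).

A lower bound needs no control of upper tails, so |·| may be truncated at M = 1/τ. The truncated
mean is at least M/B, because ‖Dv‖₂ ≥ 1/τ and fourth moments are bounded
(`RegularLaw.le_integral_truncAbs`). The truncated summands lie in [0, M], so McDiarmid's inequality
controls the largest deficit over v up to probability e^{-cm}, however heavy the tails of φ.

The expected deficit is reduced by symmetrization and contraction (`integral_ciSup_empirical_le`) to
2 E sup ⟨h, v⟩, where h = Dᵀ ∑ y_i for symmetrized rows y_i. Splitting the coordinates of h at a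
height H bounds the supremum by a multiple of √s H / γ plus a multiple of ∑ h_j^r / (√s H^{r-1})
(`nspSet.sum_mul_le`). If E h_j^r ≤ B₁^r, then H = B₁ (n/s)^{1/r} balances the two terms. For r of
order log(n/s) the factor (n/s)^{1/r} is bounded, which is why moments up to that order suffice.

The needed Gaussian size, B₁ of order ρ√(rm), comes from the truncated moment generating function
`momentPoly`, which is submultiplicative on independent sums. It is applied across the entries of a
row (`abs_integral_weighted_sum_pow_le`) and then across the rows (`abs_integral_sum_pow_le`). The
latter needs r^{2α-1} ≤ m, the source of the second term in the condition on m. An exponent α < 1 is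
replaced by 1 throughout, which matches the exponent max(2α-1, 1). -/

noncomputable section

namespace DictRecovery

/-! ### Deterministic recovery from the robust null space property -/

section Deterministic

variable {m d n : ℕ}

lemma mulVecE_smul (A : Matrix (Fin m) (Fin n) ℝ) (c : ℝ) (v : EuclideanSpace ℝ (Fin n)) :
    mulVecE A (c • v) = c • mulVecE A v := by simp [mulVecE]

lemma mulVecE_sub (A : Matrix (Fin m) (Fin n) ℝ) (v w : EuclideanSpace ℝ (Fin n)) :
    mulVecE A (v - w) = mulVecE A v - mulVecE A w := by simp [mulVecE]

lemma mulVecE_mul (A : Matrix (Fin m) (Fin d) ℝ) (B : Matrix (Fin d) (Fin n) ℝ)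
    (v : EuclideanSpace ℝ (Fin n)) : mulVecE (A * B) v = mulVecE A (mulVecE B v) := by
  simp [mulVecE, Matrix.toLpLin_apply]

lemma mulVecE_apply (A : Matrix (Fin m) (Fin n) ℝ) (v : EuclideanSpace ℝ (Fin n)) (i : Fin m) :
    mulVecE A v i = ∑ j, A i j * v j := by
  simp [mulVecE, Matrix.toLpLin_apply, Matrix.mulVec, dotProduct]

lemma continuous_mulVecE (A : Matrix (Fin m) (Fin n) ℝ) : Continuous (mulVecE A) :=
  LinearMap.continuous_of_finiteDimensional (Matrix.toEuclideanLin A)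

lemma norm_mulVecE_le (A : Matrix (Fin m) (Fin n) ℝ) (v : EuclideanSpace ℝ (Fin n)) :
    ‖mulVecE A v‖ ≤ opNorm A * ‖v‖ :=
  (LinearMap.toContinuousLinearMap (Matrix.toEuclideanLin A)).le_opNorm v

lemma opNorm_nonneg (A : Matrix (Fin m) (Fin n) ℝ) : 0 ≤ opNorm A := norm_nonneg _

lemma continuous_l1Norm : Continuous (l1Norm (n := n)) := by
  unfold l1Norm; fun_prop

lemma l1On_nonneg (T : Finset (Fin n)) (v : EuclideanSpace ℝ (Fin n)) : 0 ≤ l1On T v :=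
  Finset.sum_nonneg fun _ _ => abs_nonneg _

lemma l1On_add_compl (T : Finset (Fin n)) (v : EuclideanSpace ℝ (Fin n)) :
    l1On T v + l1On Tᶜ v = l1Norm v := Finset.sum_add_sum_compl T _

lemma l2On_le_norm (T : Finset (Fin n)) (v : EuclideanSpace ℝ (Fin n)) : l2On T v ≤ ‖v‖ := by
  rw [EuclideanSpace.norm_eq]
  refine Real.sqrt_le_sqrt ?_
  simp only [Real.norm_eq_abs, sq_abs]
  exact Finset.sum_le_univ_sum_of_nonneg fun _ => sq_nonneg _

lemma norm_le_l2On_add (T : Finset (Fin n)) (v : EuclideanSpace ℝ (Fin n)) :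
    ‖v‖ ≤ l2On T v + l2On Tᶜ v := by
  rw [EuclideanSpace.norm_eq, Real.sqrt_le_left (by unfold l2On; positivity)]
  simp only [Real.norm_eq_abs, sq_abs]
  rw [← Finset.sum_add_sum_compl T, add_sq]
  have h1 : l2On T v ^ 2 = ∑ i ∈ T, v i ^ 2 :=
    Real.sq_sqrt (Finset.sum_nonneg fun _ _ => sq_nonneg _)
  have h2 : l2On Tᶜ v ^ 2 = ∑ i ∈ Tᶜ, v i ^ 2 :=
    Real.sq_sqrt (Finset.sum_nonneg fun _ _ => sq_nonneg _)
  rw [h1, h2]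
  have : 0 ≤ 2 * l2On T v * l2On Tᶜ v := by unfold l2On; positivity
  linarith

lemma l1On_le_sqrt_card_mul_l2On (T : Finset (Fin n)) (v : EuclideanSpace ℝ (Fin n)) :
    l1On T v ≤ Real.sqrt T.card * l2On T v := by
  unfold l1On l2On
  rw [← Real.sqrt_mul (by positivity)]
  refine Real.le_sqrt_of_sq_le ?_
  simpa using sq_sum_le_card_mul_sum_sq (s := T) (f := fun i => |v i|)

lemma l1On_smul (T : Finset (Fin n)) (c : ℝ) (v : EuclideanSpace ℝ (Fin n)) :
    l1On T (c • v) = |c| * l1On T v := by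
  simp [l1On, abs_mul, Finset.mul_sum]

lemma l2On_smul (T : Finset (Fin n)) (c : ℝ) (v : EuclideanSpace ℝ (Fin n)) :
    l2On T (c • v) = |c| * l2On T v := by
  simp [l2On, mul_pow, ← Finset.mul_sum, Real.sqrt_mul (sq_nonneg c), Real.sqrt_sq_eq_abs]

/-- The robust null space property as an inequality that holds for all vectors. -/
lemma RobustNSP.l2On_le {A : Matrix (Fin m) (Fin n) ℝ} {s : ℕ} {γ τ : ℝ}
    (hA : RobustNSP A s γ τ) {T : Finset (Fin n)} (hT : T.card = s)
    (v : EuclideanSpace ℝ (Fin n)) :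
    l2On T v ≤ γ / Real.sqrt s * l1On Tᶜ v + τ * ‖mulVecE A v‖ := by
  obtain ⟨hγ, -, hτ, h⟩ := hA
  have h0 : 0 ≤ γ / Real.sqrt s * l1On Tᶜ v :=
    mul_nonneg (by positivity) (l1On_nonneg _ _)
  rcases le_total (l2On T v) (γ / Real.sqrt s * l1On Tᶜ v) with hv | hv
  · have : 0 ≤ τ * ‖mulVecE A v‖ := by positivity
    linarith
  rcases eq_or_ne v 0 with rfl | hv0
  · have : l2On T (0 : EuclideanSpace ℝ (Fin n)) = 0 := by simp [l2On]
    rw [this]; positivity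
  have hn : 0 < ‖v‖ := norm_pos_iff.2 hv0
  have hmem : ‖v‖⁻¹ • v ∈ nspSet n s γ := by
    refine ⟨by simp [norm_smul, hn.ne'], T, hT, ?_⟩
    rw [l1On_smul, l2On_smul, mul_left_comm]
    exact mul_le_mul_of_nonneg_left hv (abs_nonneg _)
  have h1 := h _ hmem
  rw [mulVecE_smul, norm_smul, norm_inv, norm_norm, div_le_iff₀ hτ, inv_mul_eq_div,
    div_mul_eq_mul_div, le_div_iff₀ hn] at h1
  have := l2On_le_norm T v
  linarith

lemma exists_superset_card {s : ℕ} (hs : s ≤ n) (J : Finset (Fin n)) (hJ : J.card ≤ s) :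
    ∃ T : Finset (Fin n), J ⊆ T ∧ T.card = s :=
  Finset.exists_superset_card_eq hJ (by simpa using hs)

/-- Some index set of size `s` carries all but an `ℓ₂`-mass of `‖v‖₁ / √s`. -/
lemma exists_l2On_compl_le {s : ℕ} (hs : 1 ≤ s) (hsn : s ≤ n) (v : EuclideanSpace ℝ (Fin n)) :
    ∃ T : Finset (Fin n), T.card = s ∧ l2On Tᶜ v ≤ l1Norm v / Real.sqrt s := by
  -- Markov's inequality at height a = ‖v‖₁ / s: at most s entries exceed a, and the others satisfy
  -- v_i² ≤ a |v_i|.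
  have hs0 : (0 : ℝ) < s := by exact_mod_cast hs
  have hl : 0 ≤ l1Norm v := Finset.sum_nonneg fun _ _ => abs_nonneg _
  set a := l1Norm v / s with ha
  have ha0 : 0 ≤ a := by positivity
  set J := Finset.univ.filter fun i => a < |v i| with hJ
  have hcard : J.card ≤ s := by
    by_contra! hlt
    have h1 : (J.card : ℝ) * a ≤ ∑ i ∈ J, |v i| := by
      rw [← nsmul_eq_mul]
      exact Finset.card_nsmul_le_sum _ _ _ fun i hi => (Finset.mem_filter.1 hi).2.le
    have hne : J.Nonempty := Finset.card_pos.1 (by omega)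
    have h2 : ∑ i ∈ J, a < ∑ i ∈ J, |v i| :=
      Finset.sum_lt_sum_of_nonempty hne fun i hi => (Finset.mem_filter.1 hi).2
    rw [Finset.sum_const, nsmul_eq_mul] at h2
    have h3 : ∑ i ∈ J, |v i| ≤ l1Norm v := Finset.sum_le_univ_sum_of_nonneg fun _ => abs_nonneg _
    have h4 : (s : ℝ) * a = l1Norm v := by rw [ha]; field_simp
    have h5 : (s : ℝ) * a ≤ J.card * a :=
      mul_le_mul_of_nonneg_right (by exact_mod_cast hlt.le) ha0
    linarith
  obtain ⟨T, hJT, hT⟩ := exists_superset_card hsn J hcard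
  refine ⟨T, hT, ?_⟩
  unfold l2On
  rw [Real.sqrt_le_left (by positivity), div_pow, Real.sq_sqrt hs0.le]
  calc ∑ i ∈ Tᶜ, v i ^ 2 ≤ ∑ i ∈ Tᶜ, a * |v i| := by
        refine Finset.sum_le_sum fun i hi => ?_
        have : |v i| ≤ a := by
          by_contra! h
          exact (Finset.mem_compl.1 hi) (hJT (by simp [hJ, h]))
        rw [← sq_abs, sq]
        exact mul_le_mul_of_nonneg_right this (abs_nonneg _)
    _ ≤ a * l1Norm v := by
        rw [← Finset.mul_sum]
        exact mul_le_mul_of_nonneg_left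
          (Finset.sum_le_univ_sum_of_nonneg fun _ => abs_nonneg _) ha0
    _ = l1Norm v ^ 2 / s := by rw [ha]; ring

/-- Vectors of smaller `ℓ₁`-norm are close to `x₀` up to the off-support mass of `x₀`. -/
lemma l1On_compl_sub_le (T : Finset (Fin n)) {x x₀ : EuclideanSpace ℝ (Fin n)}
    (h : l1Norm x ≤ l1Norm x₀) :
    l1On Tᶜ (x - x₀) ≤ l1On T (x - x₀) + 2 * l1On Tᶜ x₀ := by
  have h1 : l1On T x₀ ≤ l1On T x + l1On T (x - x₀) := by
    unfold l1On
    rw [← Finset.sum_add_distrib]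
    refine Finset.sum_le_sum fun i _ => ?_
    simp only [PiLp.sub_apply]
    have := abs_sub_abs_le_abs_sub (x₀ i) (x i)
    rw [abs_sub_comm] at this
    linarith
  have h2 : l1On Tᶜ (x - x₀) ≤ l1On Tᶜ x + l1On Tᶜ x₀ := by
    unfold l1On
    rw [← Finset.sum_add_distrib]
    exact Finset.sum_le_sum fun i _ => abs_sub _ _
  rw [← l1On_add_compl T, ← l1On_add_compl T] at h
  linarith

lemma bestTermError_nonneg (s : ℕ) (x : EuclideanSpace ℝ (Fin n)) : 0 ≤ bestTermError s x := by
  refine Real.sInf_nonneg ?_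
  rintro _ ⟨z, -, rfl⟩
  exact Finset.sum_nonneg fun _ _ => abs_nonneg _

/-- An s-sparse z is supported in some T of size s, and x - z agrees with x off T. Bounds on σ_s can
thus be proved one T at a time, without a minimizer. -/
lemma le_bestTermError_of_forall {s : ℕ} (hs : s ≤ n) {x : EuclideanSpace ℝ (Fin n)} {b : ℝ}
    (h : ∀ T : Finset (Fin n), T.card = s → b ≤ l1On Tᶜ x) : b ≤ bestTermError s x := by
  refine le_csInf (Set.Nonempty.image _ ⟨0, by simp [IsSparse]⟩) ?_
  rintro _ ⟨z, hz, rfl⟩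
  classical
  have hz' : (Finset.univ.filter fun i => z i ≠ 0).card ≤ s := by
    have hz : {i : Fin n | z i ≠ 0}.ncard ≤ s := hz
    rwa [Set.ncard_eq_toFinset_card', Set.toFinset_ofPred] at hz
  obtain ⟨T, hJ, hT⟩ := exists_superset_card hs _ hz'
  refine (h T hT).trans ?_
  calc l1On Tᶜ x = l1On Tᶜ (x - z) := by
        refine Finset.sum_congr rfl fun i hi => ?_
        have : z i = 0 := by
          by_contra h0
          exact (Finset.mem_compl.1 hi) (hJ (by simp [h0]))
        simp [this]
    _ ≤ l1Norm (x - z) := Finset.sum_le_univ_sum_of_nonneg fun _ => abs_nonneg _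

/-- `ℓ₁`-error bound for vectors of smaller `ℓ₁`-norm under the robust null space property. -/
lemma RobustNSP.l1Norm_sub_le {A : Matrix (Fin m) (Fin n) ℝ} {s : ℕ} {γ τ : ℝ}
    (hA : RobustNSP A s γ τ) (hs : 1 ≤ s) (hsn : s ≤ n) {x x₀ : EuclideanSpace ℝ (Fin n)}
    (h : l1Norm x ≤ l1Norm x₀) :
    (1 - γ) * l1Norm (x - x₀) ≤
      4 * bestTermError s x₀ + 3 * (Real.sqrt s * (τ * ‖mulVecE A (x - x₀)‖)) := by
  have hs0 : (0 : ℝ) < Real.sqrt s := Real.sqrt_pos.2 (by exact_mod_cast hs)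
  set r := Real.sqrt s * (τ * ‖mulVecE A (x - x₀)‖) with hr
  have hA' := hA
  obtain ⟨hγ, hγ1, hτ, -⟩ := hA'
  have hr0 : 0 ≤ r := by positivity
  suffices hb : ((1 - γ) * l1Norm (x - x₀) - 3 * r) / 4 ≤ bestTermError s x₀ by linarith
  refine le_bestTermError_of_forall hsn fun T hT => ?_
  have h1 := l1On_compl_sub_le T h
  have h2 : l1On T (x - x₀) ≤ γ * l1On Tᶜ (x - x₀) + r := by
    have h3 := l1On_le_sqrt_card_mul_l2On T (x - x₀)
    rw [hT] at h3
    refine h3.trans ((mul_le_mul_of_nonneg_left (hA.l2On_le hT _) hs0.le).trans (le_of_eq ?_))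
    rw [mul_add, ← hr]
    field_simp
  rw [← l1On_add_compl T]
  have h4 := l1On_nonneg T (x - x₀)
  have h5 := l1On_nonneg Tᶜ x₀
  -- The cone inequality `h1` and the null space inequality `h2` bound each other's right-hand side;
  -- since γ < 1 the loop closes.
  have h6 : (1 - γ) * l1On Tᶜ (x - x₀) ≤ r + 2 * l1On Tᶜ x₀ := by linarith
  have h7 : (1 - γ) * l1On T (x - x₀) ≤ (1 - γ) * (γ * l1On Tᶜ (x - x₀) + r) :=
    mul_le_mul_of_nonneg_left h2 (sub_pos.2 hγ1).le
  have h8 := mul_le_mul_of_nonneg_left h6 (by linarith : 0 ≤ 1 + γ)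
  have h9 := mul_nonneg (sub_pos.2 hγ1).le h5
  linarith

/-- On a set T carrying the large entries the NSP bounds the ℓ₂-mass, and off T it is at most ‖x -
x₀‖₁ / √s. The error is thus at most twice the scaled ℓ₁-error plus one noise term: 8 = 2·4 and 7 =
2·3 + 1. -/
lemma RobustNSP.norm_sub_le {A : Matrix (Fin m) (Fin n) ℝ} {s : ℕ} {γ τ : ℝ}
    (hA : RobustNSP A s γ τ) (hs : 1 ≤ s) (hsn : s ≤ n) {x x₀ : EuclideanSpace ℝ (Fin n)}
    (h : l1Norm x ≤ l1Norm x₀) :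
    (1 - γ) * ‖x - x₀‖ ≤
      8 * (bestTermError s x₀ / Real.sqrt s) + 7 * (τ * ‖mulVecE A (x - x₀)‖) := by
  have hs0 : (0 : ℝ) < Real.sqrt s := Real.sqrt_pos.2 (by exact_mod_cast hs)
  have h1 := hA.l1Norm_sub_le hs hsn h
  obtain ⟨T, hT, hT2⟩ := exists_l2On_compl_le hs hsn (x - x₀)
  have h2 := hA.l2On_le hT (x - x₀)
  have h3 := norm_le_l2On_add T (x - x₀)
  obtain ⟨hγ, hγ1, hτ, -⟩ := hA
  have hl : 0 ≤ l1Norm (x - x₀) := Finset.sum_nonneg fun _ _ => abs_nonneg _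
  have h4 : γ / Real.sqrt s * l1On Tᶜ (x - x₀) ≤ l1Norm (x - x₀) / Real.sqrt s := by
    rw [div_mul_eq_mul_div]
    refine div_le_div_of_nonneg_right ?_ hs0.le
    have := l1On_add_compl T (x - x₀)
    have := l1On_nonneg T (x - x₀)
    have := l1On_nonneg Tᶜ (x - x₀)
    nlinarith
  set w := τ * ‖mulVecE A (x - x₀)‖ with hw
  have hw0 : 0 ≤ w := by positivity
  have h5 : ‖x - x₀‖ ≤ 2 * (l1Norm (x - x₀) / Real.sqrt s) + w := by linarith
  have h6 : (1 - γ) * (l1Norm (x - x₀) / Real.sqrt s) ≤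
      4 * (bestTermError s x₀ / Real.sqrt s) + 3 * w := by
    rw [← mul_div_assoc, div_le_iff₀ hs0]
    refine h1.trans (le_of_eq ?_)
    field_simp
  nlinarith

/-- Direct method: since ‖·‖₂ ≤ ‖·‖₁, competitors no worse than x₀ lie in a Euclidean ball, which
meets the closed feasible set in a compact set. -/
lemma exists_isSynthesisSolution (Φ : Matrix (Fin m) (Fin d) ℝ) (D : Matrix (Fin d) (Fin n) ℝ)
    (y : EuclideanSpace ℝ (Fin m)) (ε : ℝ) (x₀ : EuclideanSpace ℝ (Fin n))
    (hx₀ : ‖mulVecE (Φ * D) x₀ - y‖ ≤ ε) : ∃ x, IsSynthesisSolution Φ D y ε x := by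
  set K := {x : EuclideanSpace ℝ (Fin n) | ‖mulVecE (Φ * D) x - y‖ ≤ ε} with hK
  have hclosed : IsClosed K :=
    isClosed_le (((continuous_mulVecE _).sub continuous_const).norm) continuous_const
  have hle : ∀ v : EuclideanSpace ℝ (Fin n), ‖v‖ ≤ l1Norm v := fun v => by
    have hl : 0 ≤ l1Norm v := Finset.sum_nonneg fun _ _ => abs_nonneg _
    rw [EuclideanSpace.norm_eq, Real.sqrt_le_left hl]
    simpa [l1Norm] using Finset.sum_sq_le_sq_sum_of_nonneg (s := Finset.univ)
      (f := fun i => |v i|) (fun i _ => abs_nonneg _)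
  have hcpt : IsCompact (K ∩ Metric.closedBall 0 (l1Norm x₀)) :=
    (isCompact_closedBall _ _).inter_left hclosed
  obtain ⟨x, ⟨hxK, -⟩, hmin⟩ := hcpt.exists_isMinOn
    ⟨x₀, hx₀, by simpa using hle x₀⟩ continuous_l1Norm.continuousOn
  refine ⟨x, hxK, fun x' hx' => ?_⟩
  rcases le_total (l1Norm x') (l1Norm x₀) with h | h
  · exact hmin ⟨hx', by simpa using (hle x').trans h⟩
  · exact (hmin ⟨hx₀, by simpa using hle x₀⟩ : l1Norm x ≤ l1Norm x₀).trans h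

/-- The robust null space property of `Φ D` implies stable and robust recovery. -/
theorem RobustNSP.stableRobustRecovery {Φ : Matrix (Fin m) (Fin d) ℝ}
    {D : Matrix (Fin d) (Fin n) ℝ} {s : ℕ} {γ τ K : ℝ} (hK : 0 < K) (hτ : 0 < τ)
    (h : RobustNSP (Φ * D) s γ (K * τ)) (hs : 1 ≤ s) (hsn : s ≤ n) :
    StableRobustRecovery Φ D s ((8 + 14 * K) / (1 - γ)) τ := by
  intro x₀ e ε he
  set y := mulVecE Φ (mulVecE D x₀) + e with hy
  have hfeas : ‖mulVecE (Φ * D) x₀ - y‖ ≤ ε := by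
    rw [mulVecE_mul, hy, sub_add_cancel_left, norm_neg]; exact he
  refine ⟨exists_isSynthesisSolution Φ D y ε x₀ hfeas, fun x hx => ?_⟩
  have hγ1 : 0 < 1 - γ := sub_pos.2 h.2.1
  have hε : 0 ≤ ε := (norm_nonneg _).trans he
  have h1 := h.norm_sub_le hs hsn (hx.2 x₀ hfeas)
  -- Both x and x₀ are feasible, so their images are within ε of y. This doubles the 7 of
  -- `norm_sub_le` to the 14 in the constant.
  have h2 : ‖mulVecE (Φ * D) (x - x₀)‖ ≤ 2 * ε := by
    rw [mulVecE_sub, ← sub_sub_sub_cancel_right _ _ y]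
    exact (_root_.norm_sub_le _ _).trans (by linarith [hx.1])
  have hσ : 0 ≤ bestTermError s x₀ / Real.sqrt s :=
    div_nonneg (bestTermError_nonneg _ _) (Real.sqrt_nonneg _)
  have h3 : ‖x - x₀‖ ≤ (8 + 14 * K) / (1 - γ) * (bestTermError s x₀ / Real.sqrt s + τ * ε) := by
    rw [div_mul_eq_mul_div, le_div_iff₀ hγ1, mul_comm]
    refine h1.trans ?_
    have h4 : K * τ * ‖mulVecE (Φ * D) (x - x₀)‖ ≤ K * τ * (2 * ε) :=
      mul_le_mul_of_nonneg_left h2 (by positivity)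
    have : 0 ≤ K * (bestTermError s x₀ / Real.sqrt s) := by positivity
    have : 0 ≤ τ * ε := by positivity
    nlinarith
  refine ⟨h3, ?_⟩
  rw [← mulVecE_sub, mul_left_comm]
  exact (norm_mulVecE_le D _).trans (mul_le_mul_of_nonneg_left h3 (opNorm_nonneg D))

end Deterministic

/-! ### Moments of independent sums by truncated generating functions -/

section Moments

variable {Ω : Type*} [MeasurableSpace Ω] {μ : Measure Ω}

/-- The Taylor polynomial of degree `N` of the moment generating function of `X`, with the moments
replaced by their absolute values. -/
def momentPoly (N : ℕ) (X : Ω → ℝ) (μ : Measure Ω) (t : ℝ) : ℝ :=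
  ∑ j ∈ Finset.range (N + 1), |∫ ω, X ω ^ j ∂μ| * t ^ j / (j.factorial : ℝ)

lemma momentPoly_nonneg (N : ℕ) (X : Ω → ℝ) {t : ℝ} (ht : 0 ≤ t) : 0 ≤ momentPoly N X μ t :=
  Finset.sum_nonneg fun _ _ => by positivity

/-- All terms of `momentPoly` are nonnegative, so its top one is at most the whole. This plays the
role of a Chernoff bound when only N moments exist. -/
lemma abs_integral_pow_le_momentPoly (N : ℕ) (X : Ω → ℝ) {t : ℝ} (ht : 0 < t) :
    |∫ ω, X ω ^ N ∂μ| ≤ N.factorial * (t⁻¹) ^ N * momentPoly N X μ t := by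
  have h : |∫ ω, X ω ^ N ∂μ| * t ^ N / (N.factorial : ℝ) ≤ momentPoly N X μ t :=
    Finset.single_le_sum (f := fun j => |∫ ω, X ω ^ j ∂μ| * t ^ j / (j.factorial : ℝ))
      (fun _ _ => by positivity) (Finset.self_mem_range_succ N)
  rw [div_le_iff₀ (by positivity), ← le_div_iff₀ (by positivity)] at h
  refine h.trans (le_of_eq ?_)
  rw [inv_pow]
  field_simp

lemma integrable_pow_of_memLp [IsFiniteMeasure μ] {N j : ℕ} (hj : j ≤ N) {X : Ω → ℝ}
    (hX : MemLp X N μ) : Integrable (fun ω => X ω ^ j) μ := by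
  have h : MemLp X j μ := hX.mono_exponent (by exact_mod_cast hj)
  have h1 := h.integrable_norm_pow'
  refine h1.mono' (hX.1.pow j) (Filter.Eventually.of_forall fun ω => ?_)
  simp

/-- Division by j! turns the binomial formula into a Cauchy product. Using |E X^k| instead of E
|X|^k keeps the factorization and lets the linear term of a centered variable vanish. -/
lemma abs_integral_add_pow_div_le [IsFiniteMeasure μ] {N j : ℕ} (hj : j ≤ N) {X Y : Ω → ℝ}
    (hX : MemLp X N μ) (hY : MemLp Y N μ) (hXY : IndepFun X Y μ) {t : ℝ} (ht : 0 ≤ t) :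
    |∫ ω, (X ω + Y ω) ^ j ∂μ| * t ^ j / (j.factorial : ℝ) ≤
      ∑ k ∈ Finset.range (j + 1), (|∫ ω, X ω ^ k ∂μ| * t ^ k / (k.factorial : ℝ)) *
        (|∫ ω, Y ω ^ (j - k) ∂μ| * t ^ (j - k) / ((j - k).factorial : ℝ)) := by
  have hprod : ∀ k ∈ Finset.range (j + 1),
      Integrable (fun ω => X ω ^ k * Y ω ^ (j - k)) μ := fun k hk => by
    have hk' : k ≤ j := Nat.lt_succ_iff.1 (Finset.mem_range.1 hk)
    exact (hXY.comp (measurable_id.pow_const k) (measurable_id.pow_const (j - k))).integrable_mul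
      (integrable_pow_of_memLp (hk'.trans hj) hX)
      (integrable_pow_of_memLp ((Nat.sub_le j k).trans hj) hY)
  have hint : ∫ ω, (X ω + Y ω) ^ j ∂μ =
      ∑ k ∈ Finset.range (j + 1),
        (∫ ω, X ω ^ k ∂μ) * (∫ ω, Y ω ^ (j - k) ∂μ) * (j.choose k : ℝ) := by
    simp_rw [add_pow]
    rw [integral_finsetSum _ fun k hk => (hprod k hk).mul_const _]
    refine Finset.sum_congr rfl fun k hk => ?_
    rw [integral_mul_const]
    congr 1
    exact (hXY.comp (measurable_id.pow_const k)
      (measurable_id.pow_const (j - k))).integral_mul_eq_mul_integral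
      (hX.1.pow k) (hY.1.pow (j - k))
  rw [hint]
  calc _ ≤ (∑ k ∈ Finset.range (j + 1), |∫ ω, X ω ^ k ∂μ| * |∫ ω, Y ω ^ (j - k) ∂μ| *
        (j.choose k : ℝ)) * t ^ j / (j.factorial : ℝ) := by
        refine div_le_div_of_nonneg_right ?_ (by positivity)
        refine mul_le_mul_of_nonneg_right ?_ (by positivity)
        refine (Finset.abs_sum_le_sum_abs _ _).trans (le_of_eq ?_)
        refine Finset.sum_congr rfl fun k _ => ?_
        rw [abs_mul, abs_mul, abs_of_nonneg (by positivity : (0 : ℝ) ≤ (j.choose k : ℝ))]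
    _ = _ := by
        rw [Finset.sum_mul, Finset.sum_div]
        refine Finset.sum_congr rfl fun k hk => ?_
        have hk' : k ≤ j := Nat.lt_succ_iff.1 (Finset.mem_range.1 hk)
        rw [Nat.cast_choose ℝ hk', ← Nat.add_sub_of_le hk', pow_add]
        simp only [Nat.add_sub_cancel_left]
        have := Nat.factorial_ne_zero (k + (j - k))
        field_simp

/-- `momentPoly` is submultiplicative on independent sums. -/
lemma momentPoly_add_le [IsFiniteMeasure μ] {N : ℕ} {X Y : Ω → ℝ}
    (hX : MemLp X N μ) (hY : MemLp Y N μ) (hXY : IndepFun X Y μ) {t : ℝ} (ht : 0 ≤ t) :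
    momentPoly N (X + Y) μ t ≤ momentPoly N X μ t * momentPoly N Y μ t := by
  set a : ℕ → ℝ := fun k => |∫ ω, X ω ^ k ∂μ| * t ^ k / (k.factorial : ℝ) with ha
  set b : ℕ → ℝ := fun k => |∫ ω, Y ω ^ k ∂μ| * t ^ k / (k.factorial : ℝ) with hb
  have ha0 : ∀ k, 0 ≤ a k := fun k => by positivity
  have hb0 : ∀ k, 0 ≤ b k := fun k => by positivity
  calc momentPoly N (X + Y) μ t
      ≤ ∑ j ∈ Finset.range (N + 1), ∑ k ∈ Finset.range (j + 1), a k * b (j - k) :=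
        Finset.sum_le_sum fun j hj => abs_integral_add_pow_div_le
          (Nat.lt_succ_iff.1 (Finset.mem_range.1 hj)) hX hY hXY ht
    _ = ∑ k ∈ Finset.range (N + 1), ∑ l ∈ Finset.range (N + 1 - k), a k * b l :=
        Finset.sum_range_diag_flip (N + 1) fun k l => a k * b l
    _ ≤ ∑ k ∈ Finset.range (N + 1), ∑ l ∈ Finset.range (N + 1), a k * b l := by
        refine Finset.sum_le_sum fun k _ => ?_
        exact Finset.sum_le_sum_of_subset_of_nonneg
          (Finset.range_subset_range.2 (Nat.sub_le _ _)) fun l _ _ => mul_nonneg (ha0 k) (hb0 l)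
    _ = _ := by rw [← Finset.sum_mul_sum]; rfl

lemma momentPoly_sum_le [IsProbabilityMeasure μ] {ι : Type*} {N : ℕ} {X : ι → Ω → ℝ}
    (hX : ∀ i, MemLp (X i) N μ) (hind : iIndepFun X μ) {t : ℝ} (ht : 0 ≤ t) (S : Finset ι) :
    momentPoly N (∑ i ∈ S, X i) μ t ≤ ∏ i ∈ S, momentPoly N (X i) μ t := by
  classical
  induction S using Finset.induction_on with
  | empty =>
    simp only [Finset.sum_empty, Finset.prod_empty, momentPoly]
    rw [Finset.sum_range_succ']
    simp
  | insert i S hi ih =>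
    rw [Finset.sum_insert hi, Finset.prod_insert hi]
    refine (momentPoly_add_le (hX i) (memLp_finsetSum' S fun j _ => hX j) ?_ ht).trans
      (mul_le_mul_of_nonneg_left ih (momentPoly_nonneg _ _ ht))
    exact (hind.indepFun_finsetSum_of_notMem₀ (fun j => (hX j).1.aemeasurable) hi).symm

/-- Splitting off the two lowest moments of a centered variable. -/
lemma momentPoly_le_of_centered [IsProbabilityMeasure μ] {N : ℕ} {X : Ω → ℝ}
    (hmean : ∫ ω, X ω ∂μ = 0) {t : ℝ} (ht : 0 ≤ t) {b : ℕ → ℝ} (hb : ∀ j, 0 ≤ b j)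
    (hX : ∀ j, 2 ≤ j → j ≤ N → |∫ ω, X ω ^ j ∂μ| ≤ (b j * j) ^ j) :
    momentPoly N X μ t ≤ 1 + ∑ j ∈ Finset.Ico 2 (N + 1), (Real.exp 1 * b j * t) ^ j := by
  have hterm : ∀ j ∈ Finset.Ico 2 (N + 1),
      |∫ ω, X ω ^ j ∂μ| * t ^ j / (j.factorial : ℝ) ≤ (Real.exp 1 * b j * t) ^ j := by
    intro j hj
    rw [Finset.mem_Ico] at hj
    rw [div_le_iff₀ (by positivity)]
    have hfac : (j : ℝ) ^ j ≤ Real.exp 1 ^ j * j.factorial := by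
      have := Real.pow_div_factorial_le_exp (j : ℝ) (by positivity) j
      rw [div_le_iff₀ (by positivity)] at this
      rwa [← Real.exp_nat_mul, mul_one]
    calc |∫ ω, X ω ^ j ∂μ| * t ^ j ≤ (b j * j) ^ j * t ^ j :=
          mul_le_mul_of_nonneg_right (hX j hj.1 (by omega)) (by positivity)
      _ = (b j * t) ^ j * (j : ℝ) ^ j := by rw [← mul_pow, ← mul_pow]; ring
      _ ≤ (b j * t) ^ j * (Real.exp 1 ^ j * j.factorial) :=
          mul_le_mul_of_nonneg_left hfac (pow_nonneg (mul_nonneg (hb j) ht) _)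
      _ = _ := by rw [← mul_assoc, ← mul_pow]; ring
  unfold momentPoly
  rcases N with _ | N
  · simp
  · have hr : Finset.range (N + 1 + 1) = insert 0 (insert 1 (Finset.Ico 2 (N + 1 + 1))) := by
      ext; simp; omega
    rw [hr, Finset.sum_insert (by simp), Finset.sum_insert (by simp)]
    simp only [pow_one, hmean, abs_zero, zero_mul, zero_div, zero_add, pow_zero]
    have := Finset.sum_le_sum hterm
    simpa using this

lemma rpow_eq_mul_rpow_sub_one {x α : ℝ} (hx : 0 < x) : x ^ α = x ^ (α - 1) * x := by
  rw [Real.rpow_sub_one hx.ne']; field_simp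

lemma factorial_le_pow_self (j : ℕ) : (j.factorial : ℝ) ≤ (j : ℝ) ^ j := by
  exact_mod_cast Nat.factorial_le_pow j

/-- Moments of weighted sums of independent centered variables with `‖ξ_k‖_p ≤ lam * p ^ α`. -/
lemma abs_integral_weighted_sum_pow_le [IsProbabilityMeasure μ] {ι : Type*} [Fintype ι]
    {ξ : ι → Ω → ℝ} {N : ℕ} {α lam : ℝ} (hα : 1 ≤ α) (hlam : 0 < lam)
    (hmem : ∀ k, MemLp (ξ k) N μ) (hind : iIndepFun ξ μ) (hmean : ∀ k, ∫ ω, ξ k ω ∂μ = 0)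
    (hmom : ∀ k, ∀ j : ℕ, 2 ≤ j → j ≤ N → |∫ ω, ξ k ω ^ j ∂μ| ≤ (lam * (j : ℝ) ^ α) ^ j)
    (a : ι → ℝ) {ρ : ℝ} (hρ : 0 < ρ) (ha : ∑ k, a k ^ 2 ≤ ρ ^ 2) (hN : 1 ≤ N) :
    |∫ ω, (∑ k, a k * ξ k ω) ^ N ∂μ| ≤ (4 * Real.exp 1 * lam * ρ * (N : ℝ) ^ α) ^ N := by
  have hN0 : (0 : ℝ) < N := by exact_mod_cast hN
  -- With this t the j-th term for a_k ξ_k is at most x^j, where x = |a_k| / (2ρ) ≤ 1/2. This uses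
  -- j^(α-1) ≤ N^(α-1), hence α ≥ 1. The geometric sum is at most 2x², and these add up to at most
  -- 1/2 over k.
  set t : ℝ := (2 * Real.exp 1 * lam * (N : ℝ) ^ (α - 1) * ρ)⁻¹ with ht
  have ht0 : 0 < t := by positivity
  have hone : ∀ k, momentPoly N (fun ω => a k * ξ k ω) μ t ≤ Real.exp (a k ^ 2 / (2 * ρ ^ 2)) := by
    intro k
    have h1 := momentPoly_le_of_centered (μ := μ) (N := N) (X := fun ω => a k * ξ k ω)
      (by rw [integral_const_mul, hmean, mul_zero]) ht0.le
      (b := fun j => |a k| * lam * (j : ℝ) ^ (α - 1)) (fun j => by positivity) (by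
        intro j hj hjN
        have hj0 : (0 : ℝ) < j := by exact_mod_cast (by omega : 0 < j)
        simp_rw [mul_pow]
        rw [integral_const_mul, abs_mul, abs_pow]
        calc |a k| ^ j * |∫ ω, ξ k ω ^ j ∂μ| ≤ |a k| ^ j * (lam * (j : ℝ) ^ α) ^ j :=
              mul_le_mul_of_nonneg_left (hmom k j hj hjN) (by positivity)
          _ = _ := by rw [rpow_eq_mul_rpow_sub_one hj0]; simp only [mul_pow]; ring)
    refine h1.trans ?_
    set x := |a k| / (2 * ρ) with hx
    have hx0 : 0 ≤ x := by positivity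
    have hak : |a k| ≤ ρ := by
      refine abs_le_of_sq_le_sq ?_ hρ.le
      exact (Finset.single_le_sum (f := fun k => a k ^ 2) (fun _ _ => sq_nonneg _)
        (Finset.mem_univ k)).trans ha
    have hx1 : x ≤ 1 / 2 := by
      rw [hx, div_le_div_iff₀ (by positivity) (by norm_num)]; linarith
    have h2 : ∀ j ∈ Finset.Ico 2 (N + 1),
        (Real.exp 1 * (|a k| * lam * (j : ℝ) ^ (α - 1)) * t) ^ j ≤ x ^ 2 * (1 / 2) ^ (j - 2) := by
      intro j hj
      rw [Finset.mem_Ico] at hj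
      have hle : Real.exp 1 * (|a k| * lam * (j : ℝ) ^ (α - 1)) * t ≤ x := by
        have hjN : (j : ℝ) ^ (α - 1) ≤ (N : ℝ) ^ (α - 1) :=
          Real.rpow_le_rpow (by positivity) (by exact_mod_cast (by omega : j ≤ N)) (by linarith)
        calc Real.exp 1 * (|a k| * lam * (j : ℝ) ^ (α - 1)) * t
            ≤ Real.exp 1 * (|a k| * lam * (N : ℝ) ^ (α - 1)) * t := by gcongr
          _ = x := by
              have : (0 : ℝ) < (N : ℝ) ^ (α - 1) := by positivity
              rw [ht, hx]; field_simp
      calc _ ≤ x ^ j := pow_le_pow_left₀ (by positivity) hle _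
        _ = x ^ 2 * x ^ (j - 2) := by rw [← pow_add]; congr 1; omega
        _ ≤ _ := mul_le_mul_of_nonneg_left (pow_le_pow_left₀ hx0 hx1 _) (by positivity)
    have h3 : ∑ j ∈ Finset.Ico 2 (N + 1), x ^ 2 * (1 / 2 : ℝ) ^ (j - 2) ≤ x ^ 2 * 2 := by
      rw [← Finset.mul_sum, Finset.sum_Ico_eq_sum_range]
      simp only [Nat.add_sub_cancel_left]
      refine mul_le_mul_of_nonneg_left ?_ (by positivity)
      have := Summable.sum_le_tsum (f := fun j : ℕ => (1 / 2 : ℝ) ^ j)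
        (Finset.range (N + 1 - 2)) (fun _ _ => by positivity) summable_geometric_two
      rwa [tsum_geometric_two] at this
    have h4 : x ^ 2 * 2 = a k ^ 2 / (2 * ρ ^ 2) := by
      rw [hx, div_pow, sq_abs]; field_simp
    have h5 := Real.add_one_le_exp (a k ^ 2 / (2 * ρ ^ 2))
    have h6 := Finset.sum_le_sum h2
    linarith
  have hmem' : ∀ k, MemLp (fun ω => a k * ξ k ω) N μ := fun k => (hmem k).const_mul _
  have hind' : iIndepFun (fun k ω => a k * ξ k ω) μ :=
    hind.comp (fun k x => a k * x) fun k => measurable_const_mul _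
  have hsum := momentPoly_sum_le hmem' hind' ht0.le Finset.univ
  have hprod : ∏ k, momentPoly N (fun ω => a k * ξ k ω) μ t ≤ 2 := by
    calc _ ≤ ∏ k, Real.exp (a k ^ 2 / (2 * ρ ^ 2)) :=
          Finset.prod_le_prod (fun k _ => momentPoly_nonneg _ _ ht0.le) fun k _ => hone k
      _ = Real.exp ((∑ k, a k ^ 2) / (2 * ρ ^ 2)) := by
          rw [← Real.exp_sum, Finset.sum_div]
      _ ≤ Real.exp (1 / 2) := by
          refine Real.exp_le_exp.2 ?_
          rw [div_le_div_iff₀ (by positivity) (by norm_num)]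
          linarith
      _ ≤ 2 := by
          have h := Real.exp_one_lt_d9
          have h2 : Real.exp (1 / 2) ^ 2 = Real.exp 1 := by
            rw [← Real.exp_nat_mul]; norm_num
          nlinarith [Real.exp_pos (1 / 2)]
  have hfin := abs_integral_pow_le_momentPoly (μ := μ) N (fun ω => ∑ k, a k * ξ k ω) ht0
  have heq : (∑ k, fun ω => a k * ξ k ω) = fun ω => ∑ k, a k * ξ k ω := by
    ext ω; simp
  rw [heq] at hsum
  calc _ ≤ N.factorial * (t⁻¹) ^ N * 2 :=
        hfin.trans (mul_le_mul_of_nonneg_left (hsum.trans hprod) (by positivity))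
    _ ≤ (N : ℝ) ^ N * (t⁻¹) ^ N * 2 ^ N := by
        have h2 : (2 : ℝ) ≤ 2 ^ N := by
          simpa using pow_le_pow_right₀ (one_le_two (α := ℝ)) hN
        have := factorial_le_pow_self N
        gcongr
    _ = _ := by
        rw [← mul_pow, ← mul_pow, ht, inv_inv, rpow_eq_mul_rpow_sub_one (α := α) hN0]
        congr 1
        generalize (N : ℝ) ^ (α - 1) = z
        ring

/-- Moments of sums of `m` independent centered variables with `α`-regular moments up to order `N`
are of Gaussian size as soon as `N ^ (2 α - 1) ≤ m`. -/
lemma abs_integral_sum_pow_le [IsProbabilityMeasure μ] {m : ℕ} {X : Fin m → Ω → ℝ} {N : ℕ}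
    {α b : ℝ} (hα : 1 ≤ α) (hb : 0 < b)
    (hmem : ∀ k, MemLp (X k) N μ) (hind : iIndepFun X μ) (hmean : ∀ k, ∫ ω, X k ω ∂μ = 0)
    (hmom : ∀ k, ∀ j : ℕ, 2 ≤ j → j ≤ N → |∫ ω, X k ω ^ j ∂μ| ≤ (b * (j : ℝ) ^ α) ^ j)
    (hN : 1 ≤ N) (hm : (N : ℝ) ^ (2 * α - 1) ≤ m) :
    |∫ ω, (∑ k, X k ω) ^ N ∂μ| ≤
      (2 * Real.exp 2 * 4 ^ (α - 1) * b * Real.sqrt (N * m)) ^ N := by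
  have hN0 : (0 : ℝ) < N := by exact_mod_cast hN
  have hm0 : (0 : ℝ) < m := lt_of_lt_of_le (by positivity) hm
  set w : ℝ := Real.sqrt (N / m) with hw
  have hw0 : 0 < w := Real.sqrt_pos.2 (by positivity)
  have hw2 : w ^ 2 = N / m := Real.sq_sqrt (by positivity)
  -- The hypothesis N^(2α-1) ≤ m says exactly that w N^β ≤ 1. So j - 2 of the j factors w j^β can be
  -- dropped, leaving w² j^(2β), and the choice q = 4^β absorbs j^(2β) into q^j through j ≤ 2^j.
  set β := α - 1 with hβ
  have hβ0 : 0 ≤ β := by linarith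
  have hwN : w * (N : ℝ) ^ β ≤ 1 := by
    refine (sq_le_one_iff₀ (by positivity)).1 ?_
    rw [mul_pow, hw2, div_mul_eq_mul_div, div_le_one hm0]
    refine le_trans (le_of_eq ?_) hm
    rw [← Real.rpow_mul_natCast hN0.le, ← Real.rpow_one_add' hN0.le (by positivity)]
    congr 1
    rw [hβ]; push_cast; ring
  set q : ℝ := 4 ^ β with hq
  have hq0 : 0 < q := by positivity
  set t : ℝ := w / (2 * q * Real.exp 1 * b) with ht
  have ht0 : 0 < t := by positivity
  have hone : ∀ k, momentPoly N (X k) μ t ≤ Real.exp (N / m) := by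
    intro k
    have h1 := momentPoly_le_of_centered (μ := μ) (N := N) (X := X k) (hmean k) ht0.le
      (b := fun j => b * (j : ℝ) ^ β) (fun j => by positivity) (by
        intro j hj hjN
        have hj0 : (0 : ℝ) < j := by exact_mod_cast (by omega : 0 < j)
        refine (hmom k j hj hjN).trans (le_of_eq ?_)
        rw [rpow_eq_mul_rpow_sub_one hj0, mul_assoc])
    refine h1.trans ?_
    have h2 : ∀ j ∈ Finset.Ico 2 (N + 1),
        (Real.exp 1 * (b * (j : ℝ) ^ β) * t) ^ j ≤ w ^ 2 * (1 / 2) ^ j := by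
      intro j hj
      rw [Finset.mem_Ico] at hj
      have hj0 : (0 : ℝ) < j := by exact_mod_cast (by omega : 0 < j)
      have hjN : (j : ℝ) ^ β ≤ (N : ℝ) ^ β :=
        Real.rpow_le_rpow (by positivity) (by exact_mod_cast (by omega : j ≤ N)) hβ0
      have hwj : (w * (j : ℝ) ^ β) ^ (j - 2) ≤ 1 :=
        pow_le_one₀ (by positivity) ((mul_le_mul_of_nonneg_left hjN hw0.le).trans hwN)
      have hjq : ((j : ℝ) ^ β) ^ 2 ≤ q ^ j := by
        have h2j : (j : ℝ) ≤ 2 ^ j := by exact_mod_cast Nat.lt_two_pow_self.le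
        have h3 : ((j : ℝ) ^ β) ^ 2 ≤ (((2 : ℝ) ^ j) ^ β) ^ 2 :=
          pow_le_pow_left₀ (by positivity) (Real.rpow_le_rpow hj0.le h2j hβ0) 2
        refine h3.trans (le_of_eq ?_)
        rw [hq, (by norm_num : (4 : ℝ) = 2 ^ (2 : ℝ)), ← Real.rpow_mul (by norm_num),
          ← Real.rpow_natCast, ← Real.rpow_natCast, ← Real.rpow_natCast,
          ← Real.rpow_mul (by norm_num), ← Real.rpow_mul (by norm_num),
          ← Real.rpow_mul (by norm_num)]
        congr 1; push_cast; ring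
      have hbase : Real.exp 1 * (b * (j : ℝ) ^ β) * t = (w * (j : ℝ) ^ β) * (q⁻¹ * (1 / 2)) := by
        rw [ht]; field_simp
      have hsplit : (w * (j : ℝ) ^ β) ^ j =
          (w * (j : ℝ) ^ β) ^ (j - 2) * (w ^ 2 * ((j : ℝ) ^ β) ^ 2) := by
        rw [← mul_pow, ← pow_add]; congr 1; omega
      rw [hbase, mul_pow, hsplit, mul_pow q⁻¹, inv_pow]
      calc (w * (j : ℝ) ^ β) ^ (j - 2) * (w ^ 2 * ((j : ℝ) ^ β) ^ 2) * ((q ^ j)⁻¹ * (1 / 2) ^ j)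
          ≤ 1 * (w ^ 2 * q ^ j) * ((q ^ j)⁻¹ * (1 / 2) ^ j) := by gcongr
        _ = w ^ 2 * (1 / 2) ^ j := by field_simp
    have h3 : ∑ j ∈ Finset.Ico 2 (N + 1), w ^ 2 * (1 / 2 : ℝ) ^ j ≤ w ^ 2 * 1 := by
      rw [← Finset.mul_sum]
      refine mul_le_mul_of_nonneg_left ?_ (by positivity)
      have h4 := Summable.sum_le_tsum (f := fun j : ℕ => (1 / 2 : ℝ) ^ j)
        (insert 0 (Finset.Ico 2 (N + 1))) (fun _ _ => by positivity) summable_geometric_two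
      rw [tsum_geometric_two, Finset.sum_insert (by simp), pow_zero] at h4
      linarith
    have h5 := Real.add_one_le_exp ((N : ℝ) / m)
    have h6 := Finset.sum_le_sum h2
    linarith
  have hsum := momentPoly_sum_le hmem hind ht0.le Finset.univ
  have hprod : ∏ k, momentPoly N (X k) μ t ≤ Real.exp 1 ^ N := by
    calc _ ≤ ∏ _k : Fin m, Real.exp (N / m) :=
          Finset.prod_le_prod (fun k _ => momentPoly_nonneg _ _ ht0.le) fun k _ => hone k
      _ = Real.exp 1 ^ N := by
          rw [Finset.prod_const, Finset.card_univ, Fintype.card_fin, ← Real.exp_nat_mul,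
            ← Real.exp_nat_mul]
          congr 1; field_simp
  have hfin := abs_integral_pow_le_momentPoly (μ := μ) N (fun ω => ∑ k, X k ω) ht0
  have heq : (∑ k, X k) = fun ω => ∑ k, X k ω := by
    ext ω; simp
  rw [heq] at hsum
  calc _ ≤ N.factorial * (t⁻¹) ^ N * Real.exp 1 ^ N :=
        hfin.trans (mul_le_mul_of_nonneg_left (hsum.trans hprod) (by positivity))
    _ ≤ (N : ℝ) ^ N * (t⁻¹) ^ N * Real.exp 1 ^ N := by
        have := factorial_le_pow_self N
        gcongr
    _ = _ := by
        rw [← mul_pow, ← mul_pow]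
        congr 1
        have he : Real.exp 2 = Real.exp 1 * Real.exp 1 := by rw [← Real.exp_add]; norm_num
        have hsq : (N : ℝ) / w = Real.sqrt (N * m) := by
          rw [div_eq_iff hw0.ne', hw, ← Real.sqrt_mul (by positivity)]
          rw [show (N : ℝ) * m * (N / m) = N ^ 2 by field_simp, Real.sqrt_sq hN0.le]
        rw [← hsq, ht, inv_div, he]
        field_simp

end Moments

/-! ### McDiarmid's inequality and suprema of empirical processes -/

section EmpiricalProcess

/-- Peels off one coordinate so that Fubini applies; this drives the inductions for both McDiarmid
and symmetrization. -/
lemma integral_pi_succ {E : Type*} [MeasurableSpace E] (ν : Measure E) [IsProbabilityMeasure ν]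
    {m : ℕ} (F : (Fin (m + 1) → E) → ℝ) :
    ∫ x, F x ∂(Measure.pi fun _ => ν) =
      ∫ p : E × (Fin m → E), F (Fin.cons p.1 p.2) ∂(ν.prod (Measure.pi fun _ => ν)) := by
  have h := (measurePreserving_piFinSuccAbove (fun _ : Fin (m + 1) => ν) 0).symm
  rw [← h.integral_comp']
  simp [MeasurableEquiv.piFinSuccAbove_symm_apply, Fin.insertNthEquiv]

lemma measurable_fin_cons {E : Type*} [MeasurableSpace E] {m : ℕ} :
    Measurable fun p : E × (Fin m → E) => (Fin.cons p.1 p.2 : Fin (m + 1) → E) := by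
  refine measurable_pi_lambda _ fun i => ?_
  refine Fin.cases ?_ (fun j => ?_) i
  · simpa using measurable_fst
  · simp only [Fin.cons_succ]
    fun_prop

lemma integrable_of_abs_le {E : Type*} [MeasurableSpace E] {ν : Measure E} [IsFiniteMeasure ν]
    {f : E → ℝ} (hf : Measurable f) {B : ℝ} (hB : ∀ x, |f x| ≤ B) : Integrable f ν :=
  (integrable_const B).mono' hf.aestronglyMeasurable (Filter.Eventually.of_forall hB)

/-- Hoeffding's lemma for a variable of oscillation at most `M`. -/
lemma integral_exp_le_of_oscillation {E : Type*} [MeasurableSpace E] {ν : Measure E}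
    [IsProbabilityMeasure ν] {g : E → ℝ} (hg : Measurable g) {M : ℝ}
    (hosc : ∀ x y, g y ≤ g x + M) (l : ℝ) :
    ∫ x, Real.exp (l * g x) ∂ν ≤ Real.exp (l * ∫ x, g x ∂ν + M ^ 2 * l ^ 2 / 8) := by
  obtain ⟨x₀⟩ : Nonempty E := nonempty_of_isProbabilityMeasure ν
  have hbdd : BddBelow (Set.range g) :=
    ⟨g x₀ - M, by rintro _ ⟨x, rfl⟩; linarith [hosc x x₀]⟩
  have : Nonempty E := ⟨x₀⟩
  set a := ⨅ x, g x with ha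
  have hmem : ∀ x, g x ∈ Set.Icc a (a + M) := fun x =>
    ⟨ciInf_le hbdd x, by
      have : g x - M ≤ a := le_ciInf fun y => by linarith [hosc y x]
      linarith⟩
  have h := (hasSubgaussianMGF_of_mem_Icc (μ := ν) hg.aemeasurable
    (Filter.Eventually.of_forall hmem)).mgf_le l
  rw [mgf] at h
  have hrew : ∀ x, Real.exp (l * (g x - ∫ x, g x ∂ν)) =
      Real.exp (-(l * ∫ x, g x ∂ν)) * Real.exp (l * g x) := fun x => by
    rw [← Real.exp_add]; congr 1; ring
  simp_rw [hrew] at h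
  rw [integral_const_mul, Real.exp_neg, inv_mul_le_iff₀ (Real.exp_pos _), ← Real.exp_add] at h
  refine h.trans (le_of_eq ?_)
  congr 2
  simp only [add_sub_cancel_left, NNReal.coe_pow, NNReal.coe_div, coe_nnnorm, Real.norm_eq_abs,
    NNReal.coe_ofNat, div_pow, sq_abs]
  ring

/-- The exponential moment form of McDiarmid's bounded differences inequality. -/
theorem integral_exp_le_of_bounded_differences {E : Type*} [MeasurableSpace E] (ν : Measure E)
    [IsProbabilityMeasure ν] {M : ℝ} (l : ℝ) : ∀ (m : ℕ) (f : (Fin m → E) → ℝ), Measurable f →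
    (∃ B, ∀ x, |f x| ≤ B) → (∀ x i y, f (Function.update x i y) ≤ f x + M) →
    ∫ x, Real.exp (l * f x) ∂(Measure.pi fun _ => ν) ≤
      Real.exp (l * ∫ x, f x ∂(Measure.pi fun _ => ν) + m * (M ^ 2 * l ^ 2 / 8)) := by
  intro m
  induction m with
  | zero =>
    intro f _ _ _
    have : ∀ x : Fin 0 → E, f x = f Fin.elim0 := fun x => congrArg f (Subsingleton.elim _ _)
    simp [this]
  | succ m ih =>
    rintro f hf ⟨B, hB⟩ hd
    set π : Measure (Fin m → E) := Measure.pi fun _ => ν with hπ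
    have hfc : Measurable fun p : E × (Fin m → E) => f (Fin.cons p.1 p.2) :=
      hf.comp measurable_fin_cons
    have hfy : ∀ y : E, Measurable fun x : Fin m → E => f (Fin.cons y x) := fun y =>
      hfc.comp measurable_prodMk_left
    have hexpB : ∀ r : ℝ, |r| ≤ B → |Real.exp (l * r)| ≤ Real.exp (|l| * B) := fun r hr => by
      rw [Real.abs_exp]
      refine Real.exp_le_exp.2 ((le_abs_self _).trans ?_)
      rw [abs_mul]
      exact mul_le_mul_of_nonneg_left hr (abs_nonneg l)
    have hi1 : Integrable (fun p : E × (Fin m → E) => f (Fin.cons p.1 p.2)) (ν.prod π) :=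
      integrable_of_abs_le hfc fun p => hB _
    have hi2 : Integrable (fun p : E × (Fin m → E) => Real.exp (l * f (Fin.cons p.1 p.2)))
        (ν.prod π) :=
      integrable_of_abs_le (Real.measurable_exp.comp (hfc.const_mul l)) fun p => hexpB _ (hB _)
    rw [integral_pi_succ, integral_pi_succ, integral_prod _ hi2, integral_prod _ hi1]
    -- Averaging out the other coordinates preserves the oscillation bound M. The induction
    -- hypothesis handles f with its first coordinate frozen, and Hoeffding's lemma then handles g.
    set g : E → ℝ := fun y => ∫ x, f (Fin.cons y x) ∂π with hg
    have hgm : Measurable g := hfc.stronglyMeasurable.integral_prod_right.measurable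
    have hgosc : ∀ y z, g z ≤ g y + M := by
      intro y z
      have : g y + M = ∫ x, (f (Fin.cons y x) + M) ∂π := by
        rw [integral_add (integrable_of_abs_le (hfy y) fun _ => hB _) (integrable_const _)]
        simp [hg]
      rw [this]
      refine integral_mono (integrable_of_abs_le (hfy z) fun _ => hB _)
        ((integrable_of_abs_le (hfy y) fun _ => hB _).add (integrable_const _)) fun x => ?_
      have := hd (Fin.cons y x) 0 z
      simpa using this
    have hstep : ∀ y : E, ∫ x, Real.exp (l * f (Fin.cons y x)) ∂π ≤
        Real.exp (m * (M ^ 2 * l ^ 2 / 8)) * Real.exp (l * g y) := by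
      intro y
      rw [← Real.exp_add, add_comm (_ * _) (l * g y)]
      refine ih (fun x => f (Fin.cons y x)) (hfy y) ⟨B, fun _ => hB _⟩ fun x i z => ?_
      rw [Fin.cons_update]
      exact hd _ _ _
    have hgB : ∀ y, |g y| ≤ B := fun y => by
      have := norm_integral_le_of_norm_le_const (μ := π) (f := fun x => f (Fin.cons y x))
        (Filter.Eventually.of_forall fun x => hB _)
      simpa using this
    calc ∫ y, ∫ x, Real.exp (l * f (Fin.cons y x)) ∂π ∂ν
        ≤ ∫ y, Real.exp (m * (M ^ 2 * l ^ 2 / 8)) * Real.exp (l * g y) ∂ν :=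
          integral_mono hi2.integral_prod_left
            ((integrable_of_abs_le (Real.measurable_exp.comp (hgm.const_mul l))
              fun y => hexpB _ (hgB y)).const_mul _) hstep
      _ ≤ Real.exp (m * (M ^ 2 * l ^ 2 / 8)) *
            Real.exp (l * ∫ y, g y ∂ν + M ^ 2 * l ^ 2 / 8) := by
          rw [integral_const_mul]
          exact mul_le_mul_of_nonneg_left (integral_exp_le_of_oscillation hgm hgosc l)
            (Real.exp_pos _).le
      _ = _ := by
          rw [← Real.exp_add]
          congr 1
          push_cast
          ring

/-- **McDiarmid's inequality** for functions of independent, identically distributed variables. -/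
theorem measureReal_ge_le_of_bounded_differences {E : Type*} [MeasurableSpace E] (ν : Measure E)
    [IsProbabilityMeasure ν] {M : ℝ} (hM : 0 < M) {m : ℕ} {f : (Fin m → E) → ℝ}
    (hf : Measurable f) {B : ℝ} (hB : ∀ x, |f x| ≤ B)
    (hd : ∀ x i y, f (Function.update x i y) ≤ f x + M) {δ : ℝ} (hδ : 0 ≤ δ) :
    (Measure.pi fun _ => ν).real
      {x | (∫ x, f x ∂(Measure.pi fun _ => ν)) + m * M * δ ≤ f x} ≤ Real.exp (-(2 * δ ^ 2 * m)) := by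
  -- Minimizes -l m M δ + m M² l² / 8, with value -2 δ² m.
  set l := 4 * δ / M with hl
  have hl0 : 0 ≤ l := by positivity
  have hint : Integrable (fun x => Real.exp (l * f x)) (Measure.pi fun _ : Fin m => ν) := by
    refine integrable_of_abs_le (B := Real.exp (l * B))
      (Real.measurable_exp.comp (hf.const_mul l)) fun x => ?_
    rw [Real.abs_exp]
    exact Real.exp_le_exp.2 (mul_le_mul_of_nonneg_left ((le_abs_self _).trans (hB x)) hl0)
  have h1 := measure_ge_le_exp_mul_mgf (X := f)
    ((∫ x, f x ∂(Measure.pi fun _ => ν)) + m * M * δ) hl0 hint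
  have h2 := integral_exp_le_of_bounded_differences ν (M := M) l m f hf ⟨B, hB⟩ hd
  refine h1.trans ((mul_le_mul_of_nonneg_left h2 (Real.exp_pos _).le).trans (le_of_eq ?_))
  rw [← Real.exp_add]
  congr 1
  rw [hl]
  field_simp
  ring

lemma integrable_ciSup {Ω ι : Type*} [MeasurableSpace Ω] {μ : Measure Ω} [Fintype ι] [Nonempty ι]
    {f : ι → Ω → ℝ} (hf : ∀ v, Integrable (f v) μ) : Integrable (fun x => ⨆ v, f v x) μ := by
  refine (integrable_finsetSum Finset.univ fun v _ => (hf v).abs).mono'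
    (AEMeasurable.iSup fun v => (hf v).1.aemeasurable).aestronglyMeasurable
    (Filter.Eventually.of_forall fun x => ?_)
  obtain ⟨v, hv⟩ := exists_eq_ciSup_of_finite (f := fun v => f v x)
  rw [← hv, Real.norm_eq_abs]
  exact Finset.single_le_sum (f := fun v => |f v x|) (fun _ _ => abs_nonneg _) (Finset.mem_univ v)

lemma le_ciSup_fintype {ι : Type*} [Finite ι] (a : ι → ℝ) (v : ι) : a v ≤ ⨆ v, a v :=
  le_ciSup (Set.finite_range a).bddAbove v

/-- The absolute value, truncated at the level `M`. -/
def truncAbs (M t : ℝ) : ℝ := min |t| M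

lemma measurable_truncAbs (M : ℝ) : Measurable (truncAbs M) := by
  unfold truncAbs; fun_prop

lemma truncAbs_nonneg {M : ℝ} (hM : 0 ≤ M) (t : ℝ) : 0 ≤ truncAbs M t := le_min (abs_nonneg _) hM

lemma truncAbs_le (M t : ℝ) : truncAbs M t ≤ M := min_le_right _ _

lemma truncAbs_le_abs (M t : ℝ) : truncAbs M t ≤ |t| := min_le_left _ _

lemma truncAbs_sub_le (M t u : ℝ) : truncAbs M t - truncAbs M u ≤ |t - u| := by
  unfold truncAbs
  have h1 := abs_sub_abs_le_abs_sub t u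
  have h2 := abs_nonneg (t - u)
  rcases min_cases |u| M with h | h <;> rcases min_cases |t| M with h' | h' <;> linarith

lemma integrable_truncAbs {Ω : Type*} [MeasurableSpace Ω] {ν : Measure Ω} [IsFiniteMeasure ν]
    {M : ℝ} (hM : 0 ≤ M) {g : Ω → ℝ} (hg : Measurable g) :
    Integrable (fun x => truncAbs M (g x)) ν := by
  refine integrable_of_abs_le (B := M) ((measurable_truncAbs M).comp hg) fun x => ?_
  rw [abs_of_nonneg (truncAbs_nonneg hM _)]
  exact truncAbs_le _ _

/-- The contraction principle for one Rademacher sign. -/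
lemma ciSup_add_truncAbs_le {ι : Type*} [Finite ι] [Nonempty ι] (M : ℝ) (A g : ι → ℝ) :
    (⨆ v, (A v + 2 * truncAbs M (g v))) + (⨆ v, (A v - 2 * truncAbs M (g v))) ≤
      (⨆ v, (A v + 2 * g v)) + ⨆ v, (A v - 2 * g v) := by
  obtain ⟨v, hv⟩ := exists_eq_ciSup_of_finite (f := fun v => A v + 2 * truncAbs M (g v))
  obtain ⟨w, hw⟩ := exists_eq_ciSup_of_finite (f := fun v => A v - 2 * truncAbs M (g v))
  rw [← hv, ← hw]
  have h := truncAbs_sub_le M (g v) (g w)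
  have h1 := le_ciSup_fintype (fun v => A v + 2 * g v) v
  have h2 := le_ciSup_fintype (fun v => A v + 2 * g v) w
  have h3 := le_ciSup_fintype (fun v => A v - 2 * g v) v
  have h4 := le_ciSup_fintype (fun v => A v - 2 * g v) w
  -- Truncation is 1-Lipschitz. The sign of g v - g w decides which of v, w is used in which
  -- supremum on the right.
  rcases abs_cases (g v - g w) with h' | h' <;> linarith

/-- Convexity of the supremum, from A + (f - g) = ½(A + 2f) + ½(A - 2g). It decouples the mean from
the sample without an independent copy, and produces the factor 2. -/
lemma ciSup_add_sub_le {ι : Type*} [Finite ι] [Nonempty ι] (A f g : ι → ℝ) :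
    ⨆ v, (A v + (f v - g v)) ≤
      1 / 2 * (⨆ v, (A v + 2 * f v)) + 1 / 2 * ⨆ v, (A v - 2 * g v) := by
  refine ciSup_le fun v => ?_
  have h1 := le_ciSup_fintype (fun v => A v + 2 * f v) v
  have h2 := le_ciSup_fintype (fun v => A v - 2 * g v) v
  linarith

/-- The law of `ε x` for `x` distributed according to `ν` and an independent sign `ε`. -/
def symmetrize {E : Type*} [MeasurableSpace E] [Neg E] (ν : Measure E) : Measure E :=
  (2⁻¹ : ENNReal) • (ν + ν.map Neg.neg)

/-! ### Symmetrization and contraction -/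

section Symmetrize

variable {E : Type*} [MeasurableSpace E] [InvolutiveNeg E] [MeasurableNeg E] {ν : Measure E}

instance [IsProbabilityMeasure ν] : IsProbabilityMeasure (symmetrize ν) := by
  have : IsProbabilityMeasure (ν.map Neg.neg) :=
    Measure.isProbabilityMeasure_map measurable_neg.aemeasurable
  refine ⟨?_⟩
  simp only [symmetrize, Measure.smul_apply, Measure.add_apply, measure_univ, smul_eq_mul]
  rw [one_add_one_eq_two]
  exact ENNReal.inv_mul_cancel (by norm_num) (by norm_num)

lemma integrable_symmetrize {f : E → ℝ} (hf : Integrable f ν)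
    (hf' : Integrable (fun x => f (-x)) ν) : Integrable f (symmetrize ν) := by
  refine Integrable.smul_measure (hf.add_measure ?_) (by simp)
  exact (MeasurableEquiv.neg E).measurableEmbedding.integrable_map_iff.2 hf'

lemma integral_symmetrize {f : E → ℝ} (hf : Integrable f ν)
    (hf' : Integrable (fun x => f (-x)) ν) :
    ∫ x, f x ∂(symmetrize ν) = 1 / 2 * ∫ x, f x ∂ν + 1 / 2 * ∫ x, f (-x) ∂ν := by
  have h : Integrable f (ν.map Neg.neg) :=
    (MeasurableEquiv.neg E).measurableEmbedding.integrable_map_iff.2 hf'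
  have h2 : ∫ x, f x ∂(ν.map Neg.neg) = ∫ x, f (-x) ∂ν :=
    (MeasurableEquiv.neg E).measurableEmbedding.integral_map f
  rw [symmetrize, integral_smul_measure, integral_add_measure hf h, h2]
  simp
  ring

variable [IsProbabilityMeasure ν] {ι : Type*} [Fintype ι] [Nonempty ι]

/-- Symmetrization and contraction for one variable. -/
lemma integral_ciSup_centered_le {M : ℝ} (hM : 0 ≤ M) {g : ι → E → ℝ}
    (hgm : ∀ v, Measurable (g v)) (hgi : ∀ v, Integrable (g v) ν)
    (hodd : ∀ v x, g v (-x) = -g v x) (A : ι → ℝ) :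
    ∫ x, ⨆ v, (A v + (∫ x', truncAbs M (g v x') ∂ν - truncAbs M (g v x))) ∂ν ≤
      ∫ y, ⨆ v, (A v + 2 * g v y) ∂(symmetrize ν) := by
  have hfi : ∀ v, Integrable (fun x => truncAbs M (g v x)) ν := fun v =>
    integrable_truncAbs hM (hgm v)
  have hp : Integrable (fun x => ⨆ v, (A v + 2 * truncAbs M (g v x))) ν :=
    integrable_ciSup fun v => (integrable_const _).add ((hfi v).const_mul 2)
  have hn : Integrable (fun x => ⨆ v, (A v - 2 * truncAbs M (g v x))) ν :=
    integrable_ciSup fun v => (integrable_const _).sub ((hfi v).const_mul 2)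
  have hgp : Integrable (fun x => ⨆ v, (A v + 2 * g v x)) ν :=
    integrable_ciSup fun v => (integrable_const _).add ((hgi v).const_mul 2)
  have hgn : Integrable (fun x => ⨆ v, (A v - 2 * g v x)) ν :=
    integrable_ciSup fun v => (integrable_const _).sub ((hgi v).const_mul 2)
  have hneg : (fun x => ⨆ v, (A v + 2 * g v (-x))) = fun x => ⨆ v, (A v - 2 * g v x) := by
    ext x; congr 1; ext v; rw [hodd]; ring
  have hpt : ∀ x, ⨆ v, (A v + (∫ x', truncAbs M (g v x') ∂ν - truncAbs M (g v x))) ≤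
      1 / 2 * (∫ x', ⨆ v, (A v + 2 * truncAbs M (g v x')) ∂ν) +
        1 / 2 * ⨆ v, (A v - 2 * truncAbs M (g v x)) := by
    intro x
    refine (ciSup_add_sub_le A _ _).trans ?_
    gcongr
    -- Jensen: the supremum of the means is at most the mean of the supremum.
    refine ciSup_le fun v => ?_
    have : A v + 2 * ∫ x', truncAbs M (g v x') ∂ν =
        ∫ x', (A v + 2 * truncAbs M (g v x')) ∂ν := by
      rw [integral_add (integrable_const _) ((hfi v).const_mul 2), integral_const_mul]
      simp
    rw [this]
    exact integral_mono ((integrable_const _).add ((hfi v).const_mul 2)) hp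
      fun x' => le_ciSup_fintype (fun v => A v + 2 * truncAbs M (g v x')) v
  calc _ ≤ ∫ x, (1 / 2 * (∫ x', ⨆ v, (A v + 2 * truncAbs M (g v x')) ∂ν) +
        1 / 2 * ⨆ v, (A v - 2 * truncAbs M (g v x))) ∂ν :=
        integral_mono
          (integrable_ciSup fun v => (integrable_const _).add ((integrable_const _).sub (hfi v)))
          ((integrable_const _).add (hn.const_mul _)) hpt
    _ = 1 / 2 * ∫ x, ((⨆ v, (A v + 2 * truncAbs M (g v x))) +
          ⨆ v, (A v - 2 * truncAbs M (g v x))) ∂ν := by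
        rw [integral_add (integrable_const _) (hn.const_mul _), integral_add hp hn,
          integral_const_mul (1 / 2) fun x => ⨆ v, (A v - 2 * truncAbs M (g v x))]
        simp
        ring
    _ ≤ 1 / 2 * ∫ x, ((⨆ v, (A v + 2 * g v x)) + ⨆ v, (A v - 2 * g v x)) ∂ν := by
        exact mul_le_mul_of_nonneg_left (integral_mono (hp.add hn) (hgp.add hgn) fun x =>
          ciSup_add_truncAbs_le M A fun v => g v x) (by norm_num)
    _ = _ := by
        rw [integral_symmetrize hgp (by rw [hneg]; exact hgn), hneg, integral_add hgp hgn]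
        ring

/-- Symmetrization and contraction: the expected deviation of the truncated empirical process is at
most twice the expected supremum of the symmetrized linear process. -/
theorem integral_ciSup_empirical_le {M : ℝ} (hM : 0 ≤ M) {g : ι → E → ℝ}
    (hgm : ∀ v, Measurable (g v)) (hgi : ∀ v, Integrable (g v) ν)
    (hodd : ∀ v x, g v (-x) = -g v x) (m : ℕ) : ∀ A : ι → ℝ,
    ∫ x : Fin m → E, ⨆ v, (A v + ∑ i, (∫ x', truncAbs M (g v x') ∂ν - truncAbs M (g v (x i))))
        ∂(Measure.pi fun _ => ν) ≤
      ∫ y : Fin m → E, ⨆ v, (A v + ∑ i, 2 * g v (y i)) ∂(Measure.pi fun _ => symmetrize ν) := by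
  induction m with
  | zero => intro A; simp
  | succ m ih =>
    intro A
    set π : Measure (Fin m → E) := Measure.pi fun _ => ν with hπ
    set σ : Measure (Fin m → E) := Measure.pi fun _ => symmetrize ν with hσ
    have hfi : ∀ v, Integrable (fun x => truncAbs M (g v x)) ν := fun v =>
      integrable_truncAbs hM (hgm v)
    have hgs : ∀ v, Integrable (g v) (symmetrize ν) := fun v =>
      integrable_symmetrize (hgi v) (by simp_rw [hodd]; exact (hgi v).neg)
    set c : ι → ℝ := fun v => ∫ x', truncAbs M (g v x') ∂ν with hc
    have hsx : ∀ v, Integrable (fun x : Fin m → E => ∑ i, (c v - truncAbs M (g v (x i)))) π :=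
      fun v => integrable_finsetSum _ fun i _ =>
        integrable_comp_eval (μ := fun _ : Fin m => ν) (f := fun x => c v - truncAbs M (g v x))
          ((integrable_const _).sub (hfi v))
    have hsy : ∀ v, Integrable (fun y : Fin m → E => ∑ i, 2 * g v (y i)) σ :=
      fun v => integrable_finsetSum _ fun i _ =>
        integrable_comp_eval (μ := fun _ : Fin m => symmetrize ν) (f := fun x => 2 * g v x)
          ((hgs v).const_mul 2)
    have h1 : Integrable (fun p : E × (Fin m → E) =>
        ⨆ v, (A v + ((c v - truncAbs M (g v p.1)) + ∑ i, (c v - truncAbs M (g v (p.2 i))))))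
        (ν.prod π) :=
      integrable_ciSup fun v => (integrable_const _).add
        ((((integrable_const _).sub (hfi v)).comp_fst _).add ((hsx v).comp_snd _))
    have h2 : Integrable (fun p : E × (Fin m → E) =>
        ⨆ v, (A v + ((c v - truncAbs M (g v p.1)) + ∑ i, 2 * g v (p.2 i)))) (ν.prod σ) :=
      integrable_ciSup fun v => (integrable_const _).add
        ((((integrable_const _).sub (hfi v)).comp_fst _).add ((hsy v).comp_snd _))
    have h3 : Integrable (fun p : E × (Fin m → E) =>
        ⨆ v, (A v + (2 * g v p.1 + ∑ i, 2 * g v (p.2 i)))) ((symmetrize ν).prod σ) :=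
      integrable_ciSup fun v => (integrable_const _).add
        ((((hgs v).const_mul 2).comp_fst _).add ((hsy v).comp_snd _))
    rw [integral_pi_succ, integral_pi_succ]
    simp only [Fin.sum_univ_succ, Fin.cons_zero, Fin.cons_succ]
    rw [integral_prod _ h1, integral_prod_symm _ h3]
    -- The arbitrary offset A absorbs the coordinates held fixed: the tail is replaced under a
    -- frozen first coordinate, then the first coordinate under a frozen tail.
    calc _ ≤ ∫ x, ∫ y, ⨆ v, (A v + ((c v - truncAbs M (g v x)) + ∑ i, 2 * g v (y i))) ∂σ ∂ν := by
          refine integral_mono h1.integral_prod_left h2.integral_prod_left fun x => ?_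
          simpa only [add_assoc] using ih fun v => A v + (c v - truncAbs M (g v x))
      _ = ∫ y, ∫ x, ⨆ v, (A v + ((c v - truncAbs M (g v x)) + ∑ i, 2 * g v (y i))) ∂ν ∂σ :=
          integral_integral_swap h2
      _ ≤ _ := by
          refine integral_mono h2.integral_prod_right h3.integral_prod_right fun y => ?_
          have := integral_ciSup_centered_le hM hgm hgi hodd fun v => A v + ∑ i, 2 * g v (y i)
          simpa only [add_assoc, add_comm (∑ i, 2 * g _ (y i))] using this

/-- A uniform lower tail bound for empirical `ℓ₁`-averages over a finite class. -/
theorem measureReal_exists_sum_abs_lt_le {M : ℝ} (hM : 0 < M) {g : ι → E → ℝ}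
    (hgm : ∀ v, Measurable (g v)) (hgi : ∀ v, Integrable (g v) ν)
    (hodd : ∀ v x, g v (-x) = -g v x) {m : ℕ} {p q δ : ℝ} (hδ : 0 ≤ δ)
    (hp : ∀ v, p ≤ ∫ x, truncAbs M (g v x) ∂ν)
    (hq : ∫ y : Fin m → E, ⨆ v, ∑ i, 2 * g v (y i) ∂(Measure.pi fun _ => symmetrize ν) ≤ m * q) :
    (Measure.pi fun _ => ν).real {x : Fin m → E | ∃ v, ∑ i, |g v (x i)| < m * (p - q - M * δ)} ≤
      Real.exp (-(2 * δ ^ 2 * m)) := by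
  set W : (Fin m → E) → ℝ := fun x =>
    ⨆ v, ∑ i, (∫ x', truncAbs M (g v x') ∂ν - truncAbs M (g v (x i))) with hW
  have hc : ∀ v, ∫ x', truncAbs M (g v x') ∂ν ∈ Set.Icc 0 M := fun v => by
    refine ⟨integral_nonneg fun x => truncAbs_nonneg hM.le _, ?_⟩
    have := integral_mono (μ := ν) (integrable_truncAbs hM.le (hgm v)) (integrable_const M)
      fun x => truncAbs_le M (g v x)
    simpa using this
  have hWm : Measurable W := Measurable.iSup fun v => Finset.measurable_fun_sum _ fun i _ =>
    measurable_const.sub ((measurable_truncAbs M).comp ((hgm v).comp (measurable_pi_apply i)))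
  have hWB : ∀ x, |W x| ≤ m * M := by
    intro x
    obtain ⟨v, hv⟩ := exists_eq_ciSup_of_finite
      (f := fun v => ∑ i, (∫ x', truncAbs M (g v x') ∂ν - truncAbs M (g v (x i))))
    rw [hW]
    simp only [← hv]
    refine (Finset.abs_sum_le_sum_abs _ _).trans ?_
    have : ∀ i ∈ (Finset.univ : Finset (Fin m)),
        |∫ x', truncAbs M (g v x') ∂ν - truncAbs M (g v (x i))| ≤ M := fun i _ => by
      have h1 := truncAbs_nonneg hM.le (g v (x i))
      have h2 := truncAbs_le M (g v (x i))
      have h3 := (hc v).1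
      have h4 := (hc v).2
      rw [abs_le]
      constructor <;> linarith
    simpa using Finset.sum_le_card_nsmul _ _ _ this
  -- Changing one coordinate replaces a single value in [0, M] by another.
  have hWd : ∀ x i y, W (Function.update x i y) ≤ W x + M := by
    intro x i y
    refine ciSup_le fun v => ?_
    have h := le_ciSup_fintype
      (fun v => ∑ i, (∫ x', truncAbs M (g v x') ∂ν - truncAbs M (g v (x i)))) v
    refine le_trans ?_ (add_le_add_left h M)
    rw [← Finset.add_sum_erase _ _ (Finset.mem_univ i),
      ← Finset.add_sum_erase Finset.univ
        (fun i => ∫ x', truncAbs M (g v x') ∂ν - truncAbs M (g v (x i))) (Finset.mem_univ i)]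
    have hrest : ∑ j ∈ Finset.univ.erase i,
        (∫ x', truncAbs M (g v x') ∂ν - truncAbs M (g v (Function.update x i y j))) =
        ∑ j ∈ Finset.univ.erase i, (∫ x', truncAbs M (g v x') ∂ν - truncAbs M (g v (x j))) :=
      Finset.sum_congr rfl fun j hj => by
        rw [Function.update_of_ne (Finset.ne_of_mem_erase hj)]
    rw [hrest, Function.update_self]
    have h1 := truncAbs_nonneg hM.le (g v y)
    have h2 := truncAbs_le M (g v (x i))
    linarith
  have hmc := measureReal_ge_le_of_bounded_differences ν hM hWm hWB hWd hδ
  have hEW : ∫ x, W x ∂(Measure.pi fun _ => ν) ≤ m * q := by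
    have := integral_ciSup_empirical_le hM.le hgm hgi hodd m (fun _ => 0)
    simp only [zero_add] at this
    exact this.trans hq
  refine (measureReal_mono ?_ (measure_ne_top _ _)).trans hmc
  rintro x ⟨v, hv⟩
  have h := le_ciSup_fintype
    (fun v => ∑ i, (∫ x', truncAbs M (g v x') ∂ν - truncAbs M (g v (x i)))) v
  simp only [Finset.sum_sub_distrib, Finset.sum_const, Finset.card_univ, Fintype.card_fin,
    nsmul_eq_mul] at h
  have h1 : ∑ i, truncAbs M (g v (x i)) ≤ ∑ i, |g v (x i)| :=
    Finset.sum_le_sum fun i _ => truncAbs_le_abs _ _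
  have h2 : (m : ℝ) * p ≤ m * ∫ x', truncAbs M (g v x') ∂ν :=
    mul_le_mul_of_nonneg_left (hp v) (by positivity)
  have h3 : W x = ⨆ v, (m * ∫ x', truncAbs M (g v x') ∂ν - ∑ i, truncAbs M (g v (x i))) := by
    simp [hW, Finset.sum_sub_distrib]
  simp only [Set.mem_ofPred_eq]
  rw [h3]
  linarith

end Symmetrize

end EmpiricalProcess

/-! ### Isotropic laws with regular marginal moments -/

section RegularLaw

variable {d : ℕ}

/-- The law `ν` on `ℝ^d` is isotropic, and its marginals in directions of length at most `ρ` have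
moments of order `j ≤ N` of size at most `(b ρ j ^ α) ^ j`. -/
structure RegularLaw (ν : Measure (Fin d → ℝ)) (α b : ℝ) (N : ℕ) : Prop where
  memLp : ∀ a : Fin d → ℝ, MemLp (fun x : Fin d → ℝ => ∑ k, a k * x k) N ν
  mean : ∀ a : Fin d → ℝ, ∫ x, ∑ k, a k * x k ∂ν = 0
  second : ∀ a : Fin d → ℝ, ∫ x, (∑ k, a k * x k) ^ 2 ∂ν = ∑ k, a k ^ 2
  moment : ∀ (a : Fin d → ℝ) (ρ : ℝ), 0 < ρ → ∑ k, a k ^ 2 ≤ ρ ^ 2 → ∀ j, 1 ≤ j → j ≤ N →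
    |∫ x, (∑ k, a k * x k) ^ j ∂ν| ≤ (b * ρ * (j : ℝ) ^ α) ^ j

lemma measurable_linearForm (a : Fin d → ℝ) :
    Measurable fun x : Fin d → ℝ => ∑ k, a k * x k := by fun_prop

lemma abs_integral_pow_le_of_eLpNorm_le {Ω : Type*} [MeasurableSpace Ω] {μ : Measure Ω}
    {ξ : Ω → ℝ} {j : ℕ} (hj : 1 ≤ j) (hξ : AEStronglyMeasurable ξ μ) {c : ℝ} (hc : 0 ≤ c)
    (h : eLpNorm ξ j μ ≤ ENNReal.ofReal c) : |∫ ω, ξ ω ^ j ∂μ| ≤ c ^ j := by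
  have hj0 : (0 : ℝ) < j := by exact_mod_cast hj
  have hmem : MemLp ξ j μ := ⟨hξ, h.trans_lt ENNReal.ofReal_lt_top⟩
  have hpos : 0 ≤ ∫ ω, ‖ξ ω‖ ^ (j : ℝ) ∂μ := integral_nonneg fun ω => by positivity
  rw [hmem.eLpNorm_eq_integral_rpow_norm (by exact_mod_cast (by omega : j ≠ 0)) (by simp),
    ENNReal.ofReal_le_ofReal_iff hc, ENNReal.toReal_natCast,
    Real.rpow_inv_le_iff_of_pos hpos hc hj0, Real.rpow_natCast] at h
  refine le_trans ?_ h
  refine (abs_integral_le_integral_abs).trans (le_of_eq ?_)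
  simp [Real.rpow_natCast, abs_pow]

/-- Vectors with independent entries and `α`-regular moments have a regular law. -/
theorem WellBehavedEntries.regularLaw {Ω : Type*} [MeasurableSpace Ω] {P : Measure Ω}
    [IsProbabilityMeasure P] {φ : Ω → Fin d → ℝ} {α lam q : ℝ} (hlam : 0 < lam) (hq : 4 ≤ q)
    (h : WellBehavedEntries P φ α lam q) :
    RegularLaw (P.map φ) (max α 1) (4 * Real.exp 1 * lam) ⌊q⌋₊ := by
  have hφ : AEMeasurable φ P := aemeasurable_pi_iff.2 h.aemeasurable
  have h4 : 4 ≤ ⌊q⌋₊ := Nat.le_floor (by exact_mod_cast hq)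
  have hle : ∀ j : ℕ, j ≤ ⌊q⌋₊ → (j : ℝ) ≤ q := fun j hj =>
    (Nat.le_floor_iff (by linarith)).1 hj
  have hLp : ∀ k, ∀ j : ℕ, 2 ≤ j → j ≤ ⌊q⌋₊ →
      eLpNorm (fun ω => φ ω k) j P ≤ ENNReal.ofReal (lam * (j : ℝ) ^ α) := fun k j hj hjq => by
    have := h.moment k j (by exact_mod_cast hj) (hle j hjq)
    rwa [ENNReal.ofReal_natCast] at this
  have hmem : ∀ k, MemLp (fun ω => φ ω k) ⌊q⌋₊ P := fun k =>
    ⟨(h.aemeasurable k).aestronglyMeasurable,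
      (hLp k _ (by omega) le_rfl).trans_lt ENNReal.ofReal_lt_top⟩
  have hmom : ∀ k, ∀ j : ℕ, 2 ≤ j → j ≤ ⌊q⌋₊ →
      |∫ ω, φ ω k ^ j ∂P| ≤ (lam * (j : ℝ) ^ max α 1) ^ j := fun k j hj hjq => by
    have hj1 : (1 : ℝ) ≤ j := by exact_mod_cast (by omega : 1 ≤ j)
    refine (abs_integral_pow_le_of_eLpNorm_le (by omega)
      (h.aemeasurable k).aestronglyMeasurable (by positivity) (hLp k j hj hjq)).trans ?_
    gcongr
    exact le_max_left _ _
  have hS : ∀ a : Fin d → ℝ, MemLp (fun ω => ∑ k, a k * φ ω k) ⌊q⌋₊ P := fun a =>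
    memLp_finsetSum _ fun k _ => (hmem k).const_mul (a k)
  have hmean : ∀ a : Fin d → ℝ, ∫ ω, ∑ k, a k * φ ω k ∂P = 0 := fun a => by
    rw [integral_finsetSum _ fun k _ => ((hmem k).integrable
      (by exact_mod_cast (by omega : 1 ≤ ⌊q⌋₊))).const_mul (a k)]
    simp [integral_const_mul, h.mean]
  refine ⟨fun a => ?_, fun a => ?_, fun a => ?_, fun a ρ hρ ha j hj hjq => ?_⟩
  · rw [memLp_map_measure_iff (measurable_linearForm a).aestronglyMeasurable hφ]
    exact hS a
  · rw [integral_map hφ (measurable_linearForm a).aestronglyMeasurable]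
    exact hmean a
  · rw [integral_map hφ ((measurable_linearForm a).pow_const 2).aestronglyMeasurable]
    have h2 : ∀ k, MemLp (fun ω => a k * φ ω k) 2 P := fun k =>
      ((hmem k).mono_exponent (by exact_mod_cast (by omega : 2 ≤ ⌊q⌋₊))).const_mul (a k)
    have hind : iIndepFun (fun k ω => a k * φ ω k) P :=
      h.indep.comp (fun k x => a k * x) fun k => measurable_const_mul _
    have hvar := IndepFun.variance_sum (s := Finset.univ) (fun k _ => h2 k)
      fun i _ j _ hij => hind.indepFun hij
    have heq : (∑ k, fun ω => a k * φ ω k) = fun ω => ∑ k, a k * φ ω k := by ext ω; simp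
    rw [heq, variance_of_integral_eq_zero (by fun_prop) (hmean a)] at hvar
    rw [hvar]
    refine Finset.sum_congr rfl fun k _ => ?_
    rw [variance_of_integral_eq_zero (h2 k).1.aemeasurable
      (by rw [integral_const_mul, h.mean, mul_zero])]
    simp_rw [mul_pow]
    rw [integral_const_mul, h.variance, mul_one]
  · rw [integral_map hφ ((measurable_linearForm a).pow_const j).aestronglyMeasurable]
    exact abs_integral_weighted_sum_pow_le (le_max_right _ _) hlam
      (fun k => (hmem k).mono_exponent (by exact_mod_cast hjq)) h.indep h.mean
      (fun k i hi hij => hmom k i hi (hij.trans hjq)) a hρ ha hj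

variable {ν : Measure (Fin d → ℝ)} [IsProbabilityMeasure ν] {α b : ℝ} {N : ℕ}

lemma linearForm_neg (a x : Fin d → ℝ) : ∑ k, a k * (-x) k = -∑ k, a k * x k := by
  simp [Finset.sum_neg_distrib]

/-- Moments of the symmetrized sums of `m` independent copies. -/
lemma RegularLaw.abs_integral_symmetrize_sum_pow_le (hν : RegularLaw ν α b N) (hα : 1 ≤ α)
    (hb : 0 < b) (a : Fin d → ℝ) {ρ : ℝ} (hρ : 0 < ρ) (ha : ∑ k, a k ^ 2 ≤ ρ ^ 2) {m r : ℕ}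
    (hr : 1 ≤ r) (hrN : r ≤ N) (hm : (r : ℝ) ^ (2 * α - 1) ≤ m) :
    MemLp (fun y : Fin m → Fin d → ℝ => ∑ i, ∑ k, a k * y i k) r
        (Measure.pi fun _ => symmetrize ν) ∧
      |∫ y : Fin m → Fin d → ℝ, (∑ i, ∑ k, a k * y i k) ^ r ∂(Measure.pi fun _ => symmetrize ν)| ≤
        (2 * Real.exp 2 * 4 ^ (α - 1) * (b * ρ) * Real.sqrt (r * m)) ^ r := by
  have hmem : MemLp (fun x : Fin d → ℝ => ∑ k, a k * x k) r ν :=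
    (hν.memLp a).mono_exponent (by exact_mod_cast hrN)
  have hpow : ∀ j : ℕ, (fun x : Fin d → ℝ => (∑ k, a k * (-x) k) ^ j) =
      fun x => (-1) ^ j * (∑ k, a k * x k) ^ j := fun j => by
    ext x; rw [linearForm_neg, neg_pow]
  have hsint : ∀ j ≤ r, ∫ x, (∑ k, a k * x k) ^ j ∂(symmetrize ν) =
      1 / 2 * ∫ x, (∑ k, a k * x k) ^ j ∂ν +
        1 / 2 * ((-1) ^ j * ∫ x, (∑ k, a k * x k) ^ j ∂ν) := fun j hj => by
    have hi := integrable_pow_of_memLp hj hmem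
    rw [integral_symmetrize hi (by rw [hpow]; exact hi.const_mul _), hpow, integral_const_mul]
  have hmemS : MemLp (fun x : Fin d → ℝ => ∑ k, a k * x k) r (symmetrize ν) := by
    have hr0 : (r : ENNReal) ≠ 0 := by exact_mod_cast (by omega : r ≠ 0)
    have hi := hmem.integrable_norm_rpow hr0 (by simp)
    rw [← integrable_norm_rpow_iff (measurable_linearForm a).aestronglyMeasurable hr0 (by simp)]
    refine integrable_symmetrize hi ?_
    simpa only [linearForm_neg, norm_neg] using hi
  have hmeas : ∀ i : Fin m, MeasurePreserving (Function.eval i)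
      (Measure.pi fun _ : Fin m => symmetrize ν) (symmetrize ν) := fun i =>
    measurePreserving_eval (fun _ : Fin m => symmetrize ν) i
  have hmemX : ∀ i : Fin m, MemLp (fun y : Fin m → Fin d → ℝ => ∑ k, a k * y i k) r
      (Measure.pi fun _ => symmetrize ν) := fun i => hmemS.comp_measurePreserving (hmeas i)
  have hX : ∀ (i : Fin m) (j : ℕ), ∫ y : Fin m → Fin d → ℝ, (∑ k, a k * y i k) ^ j
      ∂(Measure.pi fun _ => symmetrize ν) = ∫ x, (∑ k, a k * x k) ^ j ∂(symmetrize ν) :=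
    fun i j => integral_comp_eval (μ := fun _ : Fin m => symmetrize ν)
      (f := fun x : Fin d → ℝ => (∑ k, a k * x k) ^ j)
      ((measurable_linearForm a).pow_const j).aestronglyMeasurable
  refine ⟨memLp_finsetSum _ fun i _ => hmemX i, ?_⟩
  refine abs_integral_sum_pow_le hα (by positivity) hmemX ?_ (fun i => ?_)
    (fun i j hj hjr => ?_) hr hm
  · exact iIndepFun_pi (X := fun _ : Fin m => fun x : Fin d → ℝ => ∑ k, a k * x k)
      fun _ => (measurable_linearForm a).aemeasurable
  · have h1 := hX i 1
    simp only [pow_one] at h1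
    have h2 := hsint 1 hr
    simp only [pow_one] at h2
    rw [h1, h2, hν.mean]
    simp
  · rw [hX, hsint j hjr]
    -- Symmetrization keeps the even moments and kills the odd ones.
    refine le_trans ?_ (hν.moment a ρ hρ ha j (by omega) (hjr.trans hrN))
    rcases neg_one_pow_eq_or ℝ j with h | h
    · rw [h]; refine le_of_eq ?_; congr 1; ring
    · rw [h]
      refine le_trans (le_of_eq ?_) (abs_nonneg _)
      rw [abs_eq_zero]; ring

/-- Truncated first moments of the marginals are bounded below. -/
lemma RegularLaw.le_integral_truncAbs (hν : RegularLaw ν α b N) (hN : 4 ≤ N) {B : ℝ} (hB : 2 ≤ B)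
    (hbB : (b * 4 ^ α) ^ 4 ≤ B) {M : ℝ} (hM : 0 < M) (a : Fin d → ℝ)
    (ha : M ^ 2 ≤ ∑ k, a k ^ 2) :
    M / B ≤ ∫ x, truncAbs M (∑ k, a k * x k) ∂ν := by
  set r := Real.sqrt (∑ k, a k ^ 2) with hr
  have hMr : M ≤ r := Real.le_sqrt_of_sq_le ha
  have hr0 : 0 < r := hM.trans_le hMr
  have hr2 : r ^ 2 = ∑ k, a k ^ 2 := Real.sq_sqrt (Finset.sum_nonneg fun _ _ => sq_nonneg _)
  have hB0 : 0 < B := by linarith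
  -- A polynomial minorant integrable with four moments: with w = |t|/r and c = 1/B, 2c w² - c² w⁴ =
  -- 1 - (1 - c w²)² is at most min(w, 1). As E w² = 1 and E w⁴ ≤ B, its mean is at least 2c - c²B,
  -- which c = 1/B maximizes.
  have hpt : ∀ t : ℝ, M * (2 / B * (t ^ 2 / r ^ 2) - 1 / B ^ 2 * (t ^ 4 / r ^ 4)) ≤
      truncAbs M t := by
    intro t
    set w := |t| / r with hw
    have hw0 : 0 ≤ w := by positivity
    have ht2 : t ^ 2 / r ^ 2 = w ^ 2 := by rw [hw, div_pow, sq_abs]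
    have ht4 : t ^ 4 / r ^ 4 = w ^ 4 := by
      rw [hw, div_pow, (by norm_num : 4 = 2 * 2), pow_mul |t|, sq_abs, ← pow_mul]
    set c := 1 / B with hc
    have hc0 : 0 < c := by positivity
    have hc1 : 2 * c ≤ 1 := by rw [hc, mul_one_div, div_le_one hB0]; exact hB
    have h2B : 2 / B = 2 * c := by rw [hc]; ring
    have h3B : 1 / B ^ 2 = c ^ 2 := by rw [hc]; ring
    rw [ht2, ht4, h2B, h3B]
    refine le_min ?_ ?_
    · have htw : M * w ≤ |t| := by
        rw [hw, mul_div_assoc', div_le_iff₀ hr0, mul_comm]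
        exact mul_le_mul_of_nonneg_left hMr (abs_nonneg _)
      refine le_trans (mul_le_mul_of_nonneg_left ?_ hM.le) htw
      rcases le_total w 1 with h1 | h1
      · have : w ^ 2 ≤ w := by nlinarith
        have : 2 * c * w ^ 2 ≤ 1 * w ^ 2 := mul_le_mul_of_nonneg_right hc1 (sq_nonneg _)
        have : 0 ≤ c ^ 2 * w ^ 4 := by positivity
        linarith
      · nlinarith [sq_nonneg (1 - c * w ^ 2)]
    · have : 2 * c * w ^ 2 - c ^ 2 * w ^ 4 ≤ 1 := by nlinarith [sq_nonneg (1 - c * w ^ 2)]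
      nlinarith
  have hi2 := integrable_pow_of_memLp (by omega : 2 ≤ N) (hν.memLp a)
  have hi4 := integrable_pow_of_memLp hN (hν.memLp a)
  have h4 : ∫ x, (∑ k, a k * x k) ^ 4 ∂ν ≤ B * r ^ 4 := by
    have h := (le_abs_self _).trans (hν.moment a r hr0 hr2.ge 4 (by norm_num) hN)
    refine h.trans ?_
    have : (b * r * ((4 : ℕ) : ℝ) ^ α) ^ 4 = (b * 4 ^ α) ^ 4 * r ^ 4 := by push_cast; ring
    rw [this]
    exact mul_le_mul_of_nonneg_right hbB (by positivity)
  have hint := integral_mono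
    ((((hi2.div_const (r ^ 2)).const_mul (2 / B)).sub
      ((hi4.div_const (r ^ 4)).const_mul (1 / B ^ 2))).const_mul M)
    (integrable_truncAbs (ν := ν) hM.le (measurable_linearForm a)) fun x => hpt _
  refine le_trans ?_ hint
  simp only [Pi.sub_apply]
  rw [integral_const_mul, integral_sub ((hi2.div_const _).const_mul _)
    ((hi4.div_const _).const_mul _), integral_const_mul, integral_const_mul, integral_div,
    integral_div, hν.second, ← hr2, div_self (by positivity)]
  have h5 : 1 / B ^ 2 * ((∫ x, (∑ k, a k * x k) ^ 4 ∂ν) / r ^ 4) ≤ 1 / B ^ 2 * B := by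
    refine mul_le_mul_of_nonneg_left ?_ (by positivity)
    rw [div_le_iff₀ (by positivity)]
    exact h4
  have h6 : 1 / B ^ 2 * B = 1 / B := by field_simp
  have h7 : M / B = M * (2 / B * 1 - 1 / B) := by ring
  rw [h7]
  refine mul_le_mul_of_nonneg_left ?_ hM.le
  linarith

end RegularLaw

/-! ### Uniform lower bounds over the null space cone -/

section SmallBall

variable {m d n : ℕ}

lemma nspSet.l1Norm_le {s : ℕ} (hs : 1 ≤ s) {γ : ℝ} (hγ : 0 < γ)
    {v : EuclideanSpace ℝ (Fin n)} (hv : v ∈ nspSet n s γ) :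
    l1Norm v ≤ Real.sqrt s * (1 + 1 / γ) := by
  have hs0 : (0 : ℝ) < Real.sqrt s := Real.sqrt_pos.2 (by exact_mod_cast hs)
  obtain ⟨hv1, T, hT, hTv⟩ := hv
  have h1 := l1On_le_sqrt_card_mul_l2On T v
  have h2 : l2On T v ≤ 1 := hv1 ▸ l2On_le_norm T v
  have h3 : l1On Tᶜ v ≤ Real.sqrt s * (1 / γ) := by
    have := hTv.trans h2
    rw [div_mul_eq_mul_div, div_le_one hs0] at this
    rw [mul_one_div, le_div_iff₀ hγ, mul_comm]
    exact this
  rw [← l1On_add_compl T, mul_add, mul_one]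
  rw [hT] at h1
  have := mul_le_mul_of_nonneg_left h2 hs0.le
  linarith

/-- The support function of `S_γ` is controlled by `ℓ_r`-norms. -/
lemma nspSet.sum_mul_le {s : ℕ} (hs : 1 ≤ s) {γ : ℝ} (hγ : 0 < γ)
    {v : EuclideanSpace ℝ (Fin n)} (hv : v ∈ nspSet n s γ) (h : Fin n → ℝ) {H : ℝ} (hH : 0 < H)
    {r : ℕ} (hr : Even r) (hr2 : 2 ≤ r) :
    ∑ j, h j * v j ≤ Real.sqrt s * H * (3 / 2 + 1 / γ) +
      1 / 2 * ((Real.sqrt s * H ^ (r - 1))⁻¹ * ∑ j, h j ^ r) := by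
  have hs0 : (0 : ℝ) < Real.sqrt s := Real.sqrt_pos.2 (by exact_mod_cast hs)
  -- Small coefficients |h_j| ≤ H are paired with the ℓ₁-norm of v. For large ones, AM-GM with
  -- weight √s H uses the ℓ₂-norm, and h_j² ≤ |h_j|^r / H^(r-2) passes to the r-th power.
  have hterm : ∀ j, h j * v j ≤ H * |v j| +
      1 / 2 * (Real.sqrt s * H * v j ^ 2 + (Real.sqrt s * H ^ (r - 1))⁻¹ * h j ^ r) := by
    intro j
    have hpr : 0 ≤ h j ^ r := hr.pow_nonneg _
    have habs : h j * v j ≤ |h j| * |v j| := by rw [← abs_mul]; exact le_abs_self _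
    rcases le_total |h j| H with hle | hle
    · have h1 : |h j| * |v j| ≤ H * |v j| := mul_le_mul_of_nonneg_right hle (abs_nonneg _)
      have h2 : 0 ≤ Real.sqrt s * H * v j ^ 2 + (Real.sqrt s * H ^ (r - 1))⁻¹ * h j ^ r := by
        positivity
      linarith
    · have h1 : (Real.sqrt s * H)⁻¹ * |h j| ^ 2 ≤ (Real.sqrt s * H ^ (r - 1))⁻¹ * h j ^ r := by
        have h2 : H ^ (r - 2) ≤ |h j| ^ (r - 2) := pow_le_pow_left₀ hH.le hle _
        have h3 : h j ^ r = |h j| ^ 2 * |h j| ^ (r - 2) := by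
          rw [← pow_add, Nat.add_sub_of_le hr2, hr.pow_abs]
        have h4 : H ^ (r - 1) = H * H ^ (r - 2) := by
          rw [← pow_succ']; congr 1; omega
        rw [h3, h4]
        have h5 : (Real.sqrt s * H)⁻¹ * |h j| ^ 2 =
            (Real.sqrt s * (H * H ^ (r - 2)))⁻¹ * (|h j| ^ 2 * H ^ (r - 2)) := by
          field_simp
        rw [h5]
        gcongr
      have h6 : |h j| * |v j| ≤
          1 / 2 * (Real.sqrt s * H * |v j| ^ 2 + (Real.sqrt s * H)⁻¹ * |h j| ^ 2) := by
        set x := Real.sqrt s * H with hx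
        have hx0 : 0 < x := by positivity
        have h7 : |h j| = x * (x⁻¹ * |h j|) := by field_simp
        set y := x⁻¹ * |h j| with hy
        have h8 : x⁻¹ * |h j| ^ 2 = x * y ^ 2 := by rw [hy]; field_simp
        rw [h8, h7]
        nlinarith [mul_nonneg hx0.le (sq_nonneg (y - |v j|))]
      rw [sq_abs (v j)] at h6
      have h9 : 0 ≤ H * |v j| := by positivity
      linarith
  have hnorm : ∑ j, v j ^ 2 = 1 := by
    have := hv.1
    rw [EuclideanSpace.norm_eq, Real.sqrt_eq_one] at this
    simpa using this
  have hl1 := mul_le_mul_of_nonneg_left (nspSet.l1Norm_le hs hγ hv) hH.le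
  calc _ ≤ ∑ j, (H * |v j| +
        1 / 2 * (Real.sqrt s * H * v j ^ 2 + (Real.sqrt s * H ^ (r - 1))⁻¹ * h j ^ r)) :=
        Finset.sum_le_sum fun j _ => hterm j
    _ = H * l1Norm v + 1 / 2 * (Real.sqrt s * H * 1 +
          (Real.sqrt s * H ^ (r - 1))⁻¹ * ∑ j, h j ^ r) := by
        rw [Finset.sum_add_distrib, ← Finset.mul_sum, ← Finset.mul_sum, Finset.sum_add_distrib,
          ← Finset.mul_sum, ← Finset.mul_sum, hnorm]
        rfl
    _ ≤ _ := by linarith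

/-- The linear form `x ↦ ⟨x, D v⟩` on `ℝ^d`. -/
def dictForm (D : Matrix (Fin d) (Fin n) ℝ) (v : EuclideanSpace ℝ (Fin n)) (x : Fin d → ℝ) : ℝ :=
  ∑ k, mulVecE D v k * x k

/-- Moves D to the other side, so that the process becomes ⟨h, v⟩ with a random h in ℝ^n whose
coordinates are column marginals. -/
lemma sum_dictForm (D : Matrix (Fin d) (Fin n) ℝ) (v : EuclideanSpace ℝ (Fin n))
    (y : Fin m → Fin d → ℝ) :
    ∑ i, dictForm D v (y i) = ∑ j, (∑ i, ∑ k, D k j * y i k) * v j := by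
  simp only [dictForm, mulVecE_apply, Finset.sum_mul]
  rw [Finset.sum_comm' (s := Finset.univ) (t := fun _ => Finset.univ) (t' := Finset.univ)
    (s' := fun _ => Finset.univ) (by simp)]
  rw [Finset.sum_comm]
  conv_lhs => enter [2, i]; rw [Finset.sum_comm]
  rw [Finset.sum_comm]
  refine Finset.sum_congr rfl fun j _ => Finset.sum_congr rfl fun i _ =>
    Finset.sum_congr rfl fun k _ => by ring

/-- The expected supremum of the symmetrized linear process over finite subsets of `S_γ`. -/
lemma RegularLaw.integral_ciSup_le {ν : Measure (Fin d → ℝ)} [IsProbabilityMeasure ν]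
    {α b : ℝ} {N : ℕ} (hν : RegularLaw ν α b N) (hα : 1 ≤ α) (hb : 0 < b)
    (D : Matrix (Fin d) (Fin n) ℝ) {s : ℕ} (hs : 1 ≤ s) {γ ρ Q : ℝ} (hγ : 0 < γ)
    (hγ1 : γ < 1) (hρ : 0 < ρ) (hD : ∀ j, ‖columnE D j‖ ≤ ρ) {r : ℕ} (hr : Even r) (hr2 : 2 ≤ r)
    (hrN : r ≤ N) (hm : (r : ℝ) ^ (2 * α - 1) ≤ m) (hQ : 0 < Q) (hQr : Q ^ r = (n : ℝ) / s)
    {ι : Type*} [Fintype ι] [Nonempty ι] (u : ι → nspSet n s γ) :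
    ∫ y : Fin m → Fin d → ℝ, ⨆ v, ∑ i, 2 * dictForm D (u v) (y i)
        ∂(Measure.pi fun _ => symmetrize ν) ≤
      6 * (Real.sqrt s * (2 * Real.exp 2 * 4 ^ (α - 1) * (b * ρ) * Real.sqrt (r * m) * Q)) / γ := by
  have hs1 : (0 : ℝ) < s := by exact_mod_cast hs
  have hs0 : 0 < Real.sqrt s := Real.sqrt_pos.2 hs1
  have hr0 : (0 : ℝ) < r := by exact_mod_cast (by omega : 0 < r)
  have hm0 : (0 : ℝ) < m := lt_of_lt_of_le (by positivity) hm
  set B₁ : ℝ := 2 * Real.exp 2 * 4 ^ (α - 1) * (b * ρ) * Real.sqrt (r * m) with hB₁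
  have hB₁0 : 0 < B₁ := by positivity
  set H := B₁ * Q with hH
  have hH0 : 0 < H := by positivity
  set h : Fin n → (Fin m → Fin d → ℝ) → ℝ := fun j y => ∑ i, ∑ k, D k j * y i k with hh
  have hcol : ∀ j, ∑ k, D k j ^ 2 ≤ ρ ^ 2 := fun j => by
    have := hD j
    rw [EuclideanSpace.norm_eq, Real.sqrt_le_left hρ.le] at this
    simpa [columnE] using this
  have hmom := fun j => hν.abs_integral_symmetrize_sum_pow_le hα hb (fun k => D k j) hρ (hcol j)
    (m := m) (by omega) hrN hm
  have hint : ∀ j, Integrable (fun y => h j y ^ r) (Measure.pi fun _ => symmetrize ν) :=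
    fun j => integrable_pow_of_memLp le_rfl (hmom j).1
  have hform : ∀ v, Integrable (fun y : Fin m → Fin d → ℝ => ∑ i, 2 * dictForm D (u v) (y i))
      (Measure.pi fun _ => symmetrize ν) := fun v => by
    simp_rw [← Finset.mul_sum, sum_dictForm]
    refine (integrable_finsetSum _ fun j _ => Integrable.mul_const ?_ _).const_mul 2
    exact (hmom j).1.integrable (by exact_mod_cast (by omega : 1 ≤ r))
  set w : ℝ := (Real.sqrt s * H ^ (r - 1))⁻¹ with hw
  have hw0 : 0 < w := by positivity
  calc _ ≤ ∫ y : Fin m → Fin d → ℝ, (2 * (Real.sqrt s * H * (3 / 2 + 1 / γ)) +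
        w * ∑ j, h j y ^ r) ∂(Measure.pi fun _ => symmetrize ν) := by
        refine integral_mono (integrable_ciSup hform)
          ((integrable_const _).add ((integrable_finsetSum _ fun j _ => hint j).const_mul _))
          fun y => ciSup_le fun v => ?_
        rw [← Finset.mul_sum, sum_dictForm]
        have := nspSet.sum_mul_le hs hγ (u v).2 (fun j => h j y) hH0 hr hr2
        linarith
    _ = 2 * (Real.sqrt s * H * (3 / 2 + 1 / γ)) +
        w * ∑ j, ∫ y : Fin m → Fin d → ℝ, h j y ^ r ∂(Measure.pi fun _ => symmetrize ν) := by
        rw [integral_add (integrable_const _)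
          ((integrable_finsetSum _ fun j _ => hint j).const_mul _), integral_const_mul w,
          integral_finsetSum _ fun j _ => hint j]
        simp
    _ ≤ 2 * (Real.sqrt s * H * (3 / 2 + 1 / γ)) + w * ∑ _j : Fin n, B₁ ^ r := by
        gcongr with j _
        exact (le_abs_self _).trans (hmom j).2
    _ = 2 * (Real.sqrt s * H * (3 / 2 + 1 / γ)) + Real.sqrt s * H := by
        congr 1
        -- Since Q^r = n/s, the n tail moments add up to exactly √s H; this is the reason for H = B₁
        -- Q.
        have hHr : H ^ (r - 1) * H = B₁ ^ r * ((n : ℝ) / s) := by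
          rw [← pow_succ, Nat.sub_add_cancel (by omega), hH, mul_pow, hQr]
        have hss : Real.sqrt s * Real.sqrt s = s := Real.mul_self_sqrt hs1.le
        rw [Finset.sum_const, Finset.card_univ, Fintype.card_fin, nsmul_eq_mul, hw,
          inv_mul_eq_iff_eq_mul₀ (by positivity)]
        calc (n : ℝ) * B₁ ^ r = s * (B₁ ^ r * ((n : ℝ) / s)) := by field_simp
          _ = _ := by rw [← hHr]; nth_rewrite 1 [← hss]; ring
    _ ≤ _ := by
        have h1 : 1 ≤ 1 / γ := by rw [le_div_iff₀ hγ]; linarith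
        have h2 : 0 < Real.sqrt s * H := by positivity
        have h3 : 6 * (Real.sqrt s * H) / γ = 6 * (Real.sqrt s * H) * (1 / γ) := by ring
        rw [h3]
        nlinarith

lemma continuous_dictForm (D : Matrix (Fin d) (Fin n) ℝ) (x : Fin d → ℝ) :
    Continuous fun v => dictForm D v x := by
  have := continuous_mulVecE D
  unfold dictForm
  fun_prop

lemma measurable_dictForm (D : Matrix (Fin d) (Fin n) ℝ) (v : EuclideanSpace ℝ (Fin n)) :
    Measurable (dictForm D v) := measurable_linearForm _

/-- Shows that S_γ is nonempty and, applied to D with the NSP, that its columns have norm at least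
1/τ. -/
lemma single_mem_nspSet {s : ℕ} (hs : 1 ≤ s) (hsn : s ≤ n) {γ : ℝ} (j : Fin n) :
    EuclideanSpace.single j (1 : ℝ) ∈ nspSet n s γ := by
  obtain ⟨T, hT, hTs⟩ := exists_superset_card hsn {j} (by simpa using hs)
  refine ⟨by simp, T, hTs, ?_⟩
  have : l1On Tᶜ (EuclideanSpace.single j (1 : ℝ)) = 0 := by
    refine Finset.sum_eq_zero fun i hi => ?_
    have : i ≠ j := fun h => (Finset.mem_compl.1 hi) (hT (by simp [h]))
    simp [this]
  rw [this, mul_zero]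
  exact Real.sqrt_nonneg _

/-- A uniform lower bound for empirical `ℓ₁`-averages over finite subsets of `S_γ`. -/
lemma RegularLaw.measureReal_exists_lt_le {ν : Measure (Fin d → ℝ)} [IsProbabilityMeasure ν]
    {α b B : ℝ} {N : ℕ} (hν : RegularLaw ν α b N) (hN : 4 ≤ N) (hα : 1 ≤ α) (hb : 0 < b)
    (hB : 2 ≤ B) (hbB : (b * 4 ^ α) ^ 4 ≤ B)
    (D : Matrix (Fin d) (Fin n) ℝ) {s : ℕ} (hs : 1 ≤ s) {γ τ ρ Q : ℝ}
    (hNSP : RobustNSP D s γ τ) (hρ : 0 < ρ) (hD : ∀ j, ‖columnE D j‖ ≤ ρ) {r : ℕ} (hr : Even r)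
    (hr2 : 2 ≤ r) (hrN : r ≤ N) (hm : (r : ℝ) ^ (2 * α - 1) ≤ m) (hQ : 0 < Q)
    (hQr : Q ^ r = (n : ℝ) / s)
    (hm' : 48 * B * Real.exp 2 * 4 ^ (α - 1) * b * (ρ * τ / γ) * Real.sqrt (s * r) * Q ≤
      Real.sqrt m)
    {ι : Type*} [Fintype ι] [Nonempty ι] (u : ι → nspSet n s γ) :
    (Measure.pi fun _ => ν).real
      {x : Fin m → Fin d → ℝ | ∃ v, ∑ i, |dictForm D (u v) (x i)| < m * (1 / (2 * B * τ))} ≤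
      Real.exp (-(1 / (8 * B ^ 2) * m)) := by
  obtain ⟨hγ, hγ1, hτ, hlow⟩ := hNSP
  have hB0 : 0 < B := by linarith
  have hM : (0 : ℝ) < 1 / τ := by positivity
  have hodd : ∀ v x, dictForm D (u v) (-x) = -dictForm D (u v) x := fun v x =>
    linearForm_neg _ x
  have hgi : ∀ v, Integrable (dictForm D (u v)) ν := fun v =>
    (hν.memLp _).integrable (by exact_mod_cast (by omega : 1 ≤ N))
  have hp : ∀ v, 1 / τ / B ≤ ∫ x, truncAbs (1 / τ) (dictForm D (u v) x) ∂ν := fun v => by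
    refine hν.le_integral_truncAbs hN hB hbB hM _ ?_
    have := hlow _ (u v).2
    rw [EuclideanSpace.norm_eq, Real.le_sqrt hM.le] at this
    · simpa using this
    · exact Finset.sum_nonneg fun _ _ => sq_nonneg _
  have hq : ∫ y : Fin m → Fin d → ℝ, ⨆ v, ∑ i, 2 * dictForm D (u v) (y i)
      ∂(Measure.pi fun _ => symmetrize ν) ≤ m * (1 / (4 * B * τ)) := by
    refine (hν.integral_ciSup_le hα hb D hs hγ hγ1 hρ hD hr hr2 hrN hm hQ hQr u).trans ?_
    have h1 := mul_le_mul_of_nonneg_right hm' (by positivity : 0 ≤ Real.sqrt m * (1 / (4 * B * τ)))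
    have h2 : Real.sqrt m * (Real.sqrt m * (1 / (4 * B * τ))) = m * (1 / (4 * B * τ)) := by
      rw [← mul_assoc, Real.mul_self_sqrt (by positivity)]
    rw [h2] at h1
    refine le_trans (le_of_eq ?_) h1
    rw [Real.sqrt_mul (by positivity), Real.sqrt_mul (by positivity)]
    field_simp
    ring
  -- The mean 1/(Bτ) loses a quarter to the expected supremum and, with δ = 1/(4B), a quarter to the
  -- fluctuation; half is left.
  have hfin := measureReal_exists_sum_abs_lt_le hM (fun v => measurable_dictForm D (u v)) hgi hodd
    (m := m) (δ := 1 / (4 * B)) (by positivity) hp hq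
  have e1 : 1 / τ / B - 1 / (4 * B * τ) - 1 / τ * (1 / (4 * B)) = 1 / (2 * B * τ) := by
    field_simp; norm_num
  have e2 : 2 * (1 / (4 * B)) ^ 2 = 1 / (8 * B ^ 2) := by field_simp; norm_num
  rwa [e1, e2] at hfin

/-- A uniform lower bound for empirical `ℓ₁`-averages over `S_γ`. -/
theorem RegularLaw.exists_measurableSet {ν : Measure (Fin d → ℝ)} [IsProbabilityMeasure ν]
    {α b B : ℝ} {N : ℕ} (hν : RegularLaw ν α b N) (hN : 4 ≤ N) (hα : 1 ≤ α) (hb : 0 < b)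
    (hB : 2 ≤ B) (hbB : (b * 4 ^ α) ^ 4 ≤ B)
    (D : Matrix (Fin d) (Fin n) ℝ) {s : ℕ} (hs : 1 ≤ s) (hsn : s ≤ n) {γ τ ρ Q : ℝ}
    (hNSP : RobustNSP D s γ τ) (hρ : 0 < ρ) (hD : ∀ j, ‖columnE D j‖ ≤ ρ) {r : ℕ} (hr : Even r)
    (hr2 : 2 ≤ r) (hrN : r ≤ N) (hm : (r : ℝ) ^ (2 * α - 1) ≤ m) (hQ : 0 < Q)
    (hQr : Q ^ r = (n : ℝ) / s)
    (hm' : 48 * B * Real.exp 2 * 4 ^ (α - 1) * b * (ρ * τ / γ) * Real.sqrt (s * r) * Q ≤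
      Real.sqrt m) :
    ∃ G : Set (Fin m → Fin d → ℝ), MeasurableSet G ∧
      1 - Real.exp (-(1 / (8 * B ^ 2) * m)) ≤ (Measure.pi fun _ => ν).real G ∧
      ∀ x ∈ G, ∀ v ∈ nspSet n s γ, m * (1 / (2 * B * τ)) ≤ ∑ i, |dictForm D v (x i)| := by
  have : Nonempty (nspSet n s γ) :=
    ⟨⟨_, single_mem_nspSet hs hsn (⟨0, by omega⟩ : Fin n)⟩⟩
  set u := TopologicalSpace.denseSeq (nspSet n s γ) with hu
  set F : ℕ → Set (Fin m → Fin d → ℝ) := fun k =>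
    {x | ∃ i : Fin (k + 1), ∑ l, |dictForm D (u i) (x l)| < m * (1 / (2 * B * τ))} with hF
  have hFm : ∀ k, MeasurableSet (F k) := fun k => by
    have : F k = ⋃ i : Fin (k + 1),
        {x | ∑ l, |dictForm D (u i) (x l)| < m * (1 / (2 * B * τ))} := by
      ext x; simp [hF]
    rw [this]
    refine MeasurableSet.iUnion fun i => measurableSet_lt ?_ measurable_const
    exact Finset.measurable_fun_sum _ fun l _ =>
      ((measurable_dictForm D (u i)).comp (measurable_pi_apply l)).abs
  -- The bound does not depend on how many points are tested, so continuity from below carries it to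
  -- a dense sequence. The surviving non-strict inequality is a closed condition in v and extends to
  -- all of S_γ.
  have hmono : Monotone F := fun k k' hk x ⟨i, hi⟩ => ⟨⟨i, by omega⟩, hi⟩
  have hle : (Measure.pi fun _ => ν).real (⋃ k, F k) ≤ Real.exp (-(1 / (8 * B ^ 2) * m)) := by
    refine ENNReal.toReal_le_of_le_ofReal (Real.exp_pos _).le ?_
    rw [hmono.measure_iUnion]
    refine iSup_le fun k => ?_
    rw [ENNReal.le_ofReal_iff_toReal_le (measure_ne_top _ _) (Real.exp_pos _).le]
    exact hν.measureReal_exists_lt_le hN hα hb hB hbB D hs hNSP hρ hD hr hr2 hrN hm hQ hQr hm'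
      fun i : Fin (k + 1) => u i
  refine ⟨(⋃ k, F k)ᶜ, (MeasurableSet.iUnion hFm).compl, ?_, fun x hx v hv => ?_⟩
  · rw [probReal_compl_eq_one_sub (MeasurableSet.iUnion hFm)]
    linarith
  · have hclosed : IsClosed {w : nspSet n s γ |
        m * (1 / (2 * B * τ)) ≤ ∑ i, |dictForm D w (x i)|} := by
      refine isClosed_le continuous_const ?_
      exact continuous_finsetSum _ fun i _ =>
        ((continuous_dictForm D (x i)).comp continuous_subtype_val).abs
    have := (TopologicalSpace.denseRange_denseSeq (nspSet n s γ)).induction_on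
      (p := fun w : nspSet n s γ => m * (1 / (2 * B * τ)) ≤ ∑ i, |dictForm D w (x i)|)
      ⟨v, hv⟩ hclosed fun k => ?_
    · exact this
    · by_contra! hlt
      exact hx (Set.mem_iUnion.2 ⟨k, ⟨Fin.last k, by simpa using hlt⟩⟩)

end SmallBall

/-! ### Choice of the moment order and transfer to the random matrix -/

section Main

/-- The moment order used for a sparsity ratio with logarithm `ℓ`. -/
lemma exists_even_moment_order {κ ℓ : ℝ} (hκ : 0 < κ) (hℓ : Real.log 2 ≤ ℓ) :
    ∃ r : ℕ, Even r ∧ 2 ≤ r ∧ (r : ℝ) ≤ max 4 (κ * ℓ) ∧ (r : ℝ) ≤ (4 + κ) * ℓ ∧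
      ℓ / r ≤ 2 / κ := by
  have hℓ2 : 1 / 2 < ℓ := by linarith [Real.log_two_gt_d9]
  -- If κℓ < 4, order 2 already gives ℓ/r ≤ 2/κ. Otherwise rounding κℓ down to an even integer loses
  -- at most half of it.
  rcases lt_or_ge (κ * ℓ) 4 with h | h
  · refine ⟨2, by decide, le_rfl, le_max_of_le_left (by norm_num), ?_, ?_⟩
    · push_cast
      nlinarith [mul_pos hκ (by linarith : 0 < ℓ)]
    · rw [div_le_div_iff₀ (by norm_num) hκ]
      push_cast
      linarith
  · have hf1 := Nat.floor_le (by linarith : 0 ≤ κ * ℓ / 2)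
    have hf2 := Nat.lt_floor_add_one (κ * ℓ / 2)
    have hk : 1 ≤ ⌊κ * ℓ / 2⌋₊ := Nat.le_floor (by push_cast; linarith)
    have hk0 : (1 : ℝ) ≤ ⌊κ * ℓ / 2⌋₊ := by exact_mod_cast hk
    refine ⟨2 * ⌊κ * ℓ / 2⌋₊, even_two_mul _, by omega, le_max_of_le_right ?_, ?_, ?_⟩
    · push_cast; linarith
    · push_cast; nlinarith
    · push_cast
      rw [div_le_div_iff₀ (by linarith) hκ]
      linarith

/-- Lower `ℓ₁`-bounds for the unscaled rows give the robust null space property. -/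
lemma robustNSP_of_le_sum_abs {m d n s : ℕ} {γ τ B : ℝ} (hm : 0 < m)
    {D : Matrix (Fin d) (Fin n) ℝ} (hD : RobustNSP D s γ τ) (hB : 0 < B)
    {A : Matrix (Fin m) (Fin d) ℝ}
    (h : ∀ v ∈ nspSet n s γ, m * (1 / (2 * B * τ)) ≤
      ∑ i, |dictForm D v fun k => Real.sqrt m * A i k|) :
    RobustNSP (A * D) s γ (2 * B * τ) := by
  obtain ⟨hγ, hγ1, hτ, -⟩ := hD
  have hm0 : (0 : ℝ) < m := by exact_mod_cast hm
  have hs0 : 0 < Real.sqrt m := Real.sqrt_pos.2 hm0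
  refine ⟨hγ, hγ1, by positivity, fun v hv => ?_⟩
  have h1 := h v hv
  have h2 : ∀ i, |dictForm D v fun k => Real.sqrt m * A i k| =
      Real.sqrt m * |mulVecE (A * D) v i| := fun i => by
    rw [mulVecE_mul, mulVecE_apply A, dictForm, ← abs_of_pos hs0, ← abs_mul, Finset.mul_sum,
      abs_of_pos hs0]
    congr 1
    exact Finset.sum_congr rfl fun k _ => by ring
  simp_rw [h2] at h1
  rw [← Finset.mul_sum] at h1
  have h3 := l1On_le_sqrt_card_mul_l2On Finset.univ (mulVecE (A * D) v)
  rw [Finset.card_univ, Fintype.card_fin] at h3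
  have h4 := l2On_le_norm Finset.univ (mulVecE (A * D) v)
  have h5 : (m : ℝ) * (1 / (2 * B * τ)) ≤ m * ‖mulVecE (A * D) v‖ := by
    calc _ ≤ Real.sqrt m * l1On Finset.univ (mulVecE (A * D) v) := h1
      _ ≤ Real.sqrt m * (Real.sqrt m * ‖mulVecE (A * D) v‖) :=
          mul_le_mul_of_nonneg_left (h3.trans (mul_le_mul_of_nonneg_left h4 hs0.le)) hs0.le
      _ = _ := by rw [← mul_assoc, Real.mul_self_sqrt hm0.le]
  exact le_of_mul_le_mul_left h5 hm0

/-- The rescaled rows of `Φ` form a product measure. -/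
lemma HasIIDRows.map_eq {Ω Ω' : Type*} [MeasurableSpace Ω] [MeasurableSpace Ω'] {P : Measure Ω}
    {P' : Measure Ω'} [IsProbabilityMeasure P] {m d : ℕ}
    {Φ : Ω → Matrix (Fin m) (Fin d) ℝ} {φ : Ω' → Fin d → ℝ} (h : HasIIDRows P P' Φ φ)
    (hm : 0 < m) :
    AEMeasurable (fun ω (i : Fin m) (k : Fin d) => Real.sqrt m * Φ ω i k) P ∧
      P.map (fun ω (i : Fin m) (k : Fin d) => Real.sqrt m * Φ ω i k) =
        Measure.pi fun _ => P'.map φ := by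
  have hs0 : Real.sqrt m ≠ 0 := (Real.sqrt_pos.2 (by exact_mod_cast hm)).ne'
  have hmeas : Measurable fun (x : Fin d → ℝ) (k : Fin d) => Real.sqrt m * x k := by fun_prop
  have hid : ∀ i : Fin m, IdentDistrib (fun ω (k : Fin d) => Real.sqrt m * Φ ω i k) φ P P' := by
    intro i
    have := (h.law i).comp hmeas
    convert! this using 1
    ext ω k
    simp only [Function.comp]
    field_simp
  have hind : iIndepFun (fun (i : Fin m) ω (k : Fin d) => Real.sqrt m * Φ ω i k) P :=
    h.indep.comp (fun _ => fun (x : Fin d → ℝ) (k : Fin d) => Real.sqrt m * x k) fun _ => hmeas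
  refine ⟨aemeasurable_pi_iff.2 fun i => (hid i).aemeasurable_fst, ?_⟩
  rw [(iIndepFun_iff_map_fun_eq_pi_map fun i => (hid i).aemeasurable_fst).1 hind]
  congr 1
  ext1 i
  exact (hid i).map_eq

end Main

end DictRecovery

end

theorem mainTheorem3 (α lam κ : ℝ) (hα : 1 / 2 ≤ α) (hlam : 0 < lam) (hκ : 0 < κ) :
    ∃ C c K R : ℝ, 0 < C ∧ 0 < c ∧ 0 < K ∧ 0 < R ∧
      ∀ (m d n s : ℕ), 1 ≤ s → 2 * s ≤ n →
      ∀ (D : Matrix (Fin d) (Fin n) ℝ) (γ τ ρ : ℝ),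
        DictRecovery.RobustNSP D s γ τ →
        (∀ j, ‖DictRecovery.columnE D j‖ ≤ ρ) →
      ∀ (Ω : Type*) [MeasurableSpace Ω] (P : Measure Ω) [IsProbabilityMeasure P]
        (Ω' : Type*) [MeasurableSpace Ω'] (P' : Measure Ω') [IsProbabilityMeasure P']
        (Φ : Ω → Matrix (Fin m) (Fin d) ℝ) (φ : Ω' → Fin d → ℝ),
        DictRecovery.WellBehavedEntries P' φ α lam
          (max 4 (κ * Real.log ((n : ℝ) / (s : ℝ)))) →
        DictRecovery.HasIIDRows P P' Φ φ →
        C * max ((ρ * τ / γ) ^ 2 * ((s : ℝ) * Real.log ((n : ℝ) / (s : ℝ))))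
            (Real.log ((n : ℝ) / (s : ℝ)) ^ (max (2 * α - 1) 1)) ≤ (m : ℝ) →
        ∃ E : Set Ω, MeasurableSet E ∧ 1 - Real.exp (-(c * (m : ℝ))) ≤ P.real E ∧
          ∀ ω ∈ E,
            DictRecovery.RobustNSP (Φ ω * D) s γ (K * τ) ∧
            DictRecovery.StableRobustRecovery (Φ ω) D s (R / (1 - γ)) τ := by
  set β := max α 1 with hβ
  have hβ1 : 1 ≤ β := le_max_right _ _
  set b := 4 * Real.exp 1 * lam with hb
  have hb0 : 0 < b := by positivity
  set B := max 2 ((b * 4 ^ β) ^ 4) with hB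
  have hB2 : 2 ≤ B := le_max_left _ _
  have hB0 : 0 < B := by linarith
  set A := 48 * B * Real.exp 2 * 4 ^ (β - 1) * b with hA
  have hA0 : 0 < A := by positivity
  -- `C₁` makes the expected supremum small enough, through r ≤ (4+κ)ℓ and Q ≤ exp(2/κ); `C₂`
  -- ensures r^(2β-1) ≤ m.
  set C₁ := A ^ 2 * (4 + κ) * Real.exp (2 / κ) ^ 2 with hC₁
  set C₂ := (4 + κ) ^ (2 * β - 1) with hC₂
  have hC₁0 : 0 < C₁ := by positivity
  have hC₂0 : 0 < C₂ := by positivity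
  have hexpo : max (2 * α - 1) 1 = 2 * β - 1 := by
    rw [hβ]
    rcases le_total α 1 with h | h
    · rw [max_eq_right h, max_eq_right (by linarith)]; norm_num
    · rw [max_eq_left h, max_eq_left (by linarith)]
  refine ⟨max C₁ C₂, 1 / (8 * B ^ 2), 2 * B, 8 + 14 * (2 * B), lt_max_of_lt_left hC₁0,
    by positivity, by positivity, by positivity, ?_⟩
  intro m d n s hs hsn D γ τ ρ hD hcol Ω _ P _ Ω' _ P' _ Φ φ hφ hΦ hm
  obtain ⟨hγ, hγ1, hτ, hlow⟩ := id hD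
  have hs0 : (0 : ℝ) < s := by exact_mod_cast hs
  have hn2 : (2 : ℝ) ≤ (n : ℝ) / s := by
    rw [le_div_iff₀ hs0]; exact_mod_cast hsn
  set ℓ := Real.log ((n : ℝ) / s) with hℓ
  have hℓ2 : Real.log 2 ≤ ℓ := Real.log_le_log (by norm_num) hn2
  have hℓ0 : 0 < ℓ := (Real.log_pos (by norm_num)).trans_le hℓ2
  obtain ⟨r, hr, hr2, hrq, hrℓ, hrκ⟩ := DictRecovery.exists_even_moment_order hκ hℓ2
  have hr0 : (0 : ℝ) < r := by exact_mod_cast (by omega : 0 < r)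
  -- A coordinate vector lies in S_γ, so some column has norm at least 1/τ.
  have hρ : 0 < ρ := by
    have hj := hlow _ (DictRecovery.single_mem_nspSet hs (by omega) (⟨0, by omega⟩ : Fin n))
    have heq : DictRecovery.mulVecE D (EuclideanSpace.single (⟨0, by omega⟩ : Fin n) (1 : ℝ)) =
        DictRecovery.columnE D ⟨0, by omega⟩ := by
      ext i
      simp [DictRecovery.mulVecE_apply, DictRecovery.columnE]
    rw [heq] at hj
    exact (by positivity : 0 < 1 / τ).trans_le (hj.trans (hcol _))
  have hm2 : (r : ℝ) ^ (2 * β - 1) ≤ m := by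
    calc (r : ℝ) ^ (2 * β - 1) ≤ ((4 + κ) * ℓ) ^ (2 * β - 1) :=
          Real.rpow_le_rpow hr0.le hrℓ (by linarith)
      _ = C₂ * ℓ ^ (2 * β - 1) := Real.mul_rpow (by positivity) hℓ0.le
      _ ≤ _ := mul_le_mul (le_max_right _ _) (hexpo ▸ le_max_right _ _) (by positivity)
          (by positivity)
      _ ≤ m := hm
  have hm0 : 0 < m := by
    have : (0 : ℝ) < m := lt_of_lt_of_le (by positivity) hm2
    exact_mod_cast this
  set Q := Real.exp (ℓ / r) with hQ
  have hQr : Q ^ r = (n : ℝ) / s := by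
    rw [hQ, ← Real.exp_nat_mul, mul_div_cancel₀ _ hr0.ne', hℓ, Real.exp_log (by linarith)]
  have hm1 : A * (ρ * τ / γ) * Real.sqrt (s * r) * Q ≤ Real.sqrt m := by
    refine Real.le_sqrt_of_sq_le ?_
    calc (A * (ρ * τ / γ) * Real.sqrt (s * r) * Q) ^ 2
        = A ^ 2 * (ρ * τ / γ) ^ 2 * (s * r) * Q ^ 2 := by
          rw [mul_pow, mul_pow, mul_pow, Real.sq_sqrt (by positivity)]
      _ ≤ A ^ 2 * (ρ * τ / γ) ^ 2 * (s * ((4 + κ) * ℓ)) * Real.exp (2 / κ) ^ 2 := by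
          have : Q ≤ Real.exp (2 / κ) := Real.exp_le_exp.2 hrκ
          gcongr
      _ = C₁ * ((ρ * τ / γ) ^ 2 * (s * ℓ)) := by rw [hC₁]; ring
      _ ≤ _ := mul_le_mul (le_max_left _ _) (le_max_left _ _) (by positivity) (by positivity)
      _ ≤ m := hm
  have hq4 : (4 : ℝ) ≤ max 4 (κ * ℓ) := le_max_left _ _
  have hlaw := hφ.regularLaw hlam hq4
  have : IsProbabilityMeasure (P'.map φ) :=
    Measure.isProbabilityMeasure_map (aemeasurable_pi_iff.2 hφ.aemeasurable)
  obtain ⟨G, hGm, hGP, hG⟩ := hlaw.exists_measurableSet (m := m)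
    (Nat.le_floor (by exact_mod_cast hq4)) hβ1 hb0 hB2 (le_max_right _ _) D hs (by omega) hD hρ
    hcol hr hr2 (Nat.le_floor hrq) hm2 (Real.exp_pos _) hQr hm1
  obtain ⟨hae, hmap⟩ := hΦ.map_eq hm0
  -- Φ is only a.e. measurable, so the preimage of `G` is merely null measurable and is shrunk to a
  -- measurable set of equal measure.
  obtain ⟨E, hE, hEm, hEae⟩ := (hae.nullMeasurableSet_preimage hGm).exists_measurable_subset_ae_eq
  refine ⟨E, hEm, ?_, fun ω hω => ?_⟩
  · rw [measureReal_congr hEae, ← map_measureReal_apply_of_aemeasurable hae hGm, hmap]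
    exact hGP
  · have h := DictRecovery.robustNSP_of_le_sum_abs hm0 hD hB0 (A := Φ ω) (hG _ (hE hω))
    exact ⟨h, h.stableRobustRecovery (by positivity) hτ hs (by omega)⟩
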